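/- Let $n\in\mathbb N$ and, for $i=1,\dots,n$, let $V_i$ be a real Banach space with its Borel $\sigma$-algebra, $\mu_i$ a Borel probability measure on $V_i$, and $W_i\subset V_i$ a compact convex set with $\mu_i(W_i)=1$. Put $V=V_1\times\dots\times V_n$ with norm $\|x\|_V=\max_i\|x_i\|_{V_i}$, $W=W_1\times\dots\times W_n$ and $\mu=\mu_1\times\dots\times\mu_n$. Let $f:V\to\mathbb R$ be twice Fréchet differentiable in the following sense: $f$ is Fréchet differentiable at every $x\in V$, with derivative $f'(x)$ and partial differentials $f_i(x)(r_i):=f'(x)(0,\dots,r_i,\dots,0)$ for $r_i\in V_i$; and for every $i$ and every $z_i\in V_i$ the function $x\mapsto f_i(x)(z_i)$ is Fréchet differentiable on $V$, with derivative $f_i'(x)(z_i,\cdot)$; put $f_{ij}(x)(z_i,r_j):=f_i'(x)(z_i,(0,\dots,r_j,\dots,0))$ for $r_j\in V_j$. Write $\|f_i(x)\|$ for the norm of the functional $f_i(x)$ and $\|f_{ij}(x)\|:=\sup\{|f_{ij}(x)(z_i,r_j)|:\max(\|r_j\|_{V_j},\|z_i\|_{V_i})\le 1\}$. Let $a,b_i,c_{ij}>0$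 be such that for all $x\in W$ and all $i,j$ $$|f(x)|\le a,\qquad \|f_i(x)\|\le b_i,\qquad \|f_{ij}(x)\|\le c_{ij}.$$ Let $M>0$ be such that $\|z-z'\|_{V_i}\le M$ for all $i$ and all $z,z'\in W_i$. Let $\epsilon>0$ and let $\mathcal D(\epsilon)$ be a finite set of tuples $d=(d_1,\dots,d_n)$ of bounded linear functionals $d_i:V_i\to\mathbb R$ such that for every $x\in W$ there is $d\in\mathcal D(\epsilon)$ with $\sum_{i=1}^n\|f_i(x)-d_i\|^2\le\epsilon^2 n$. For a product $\nu=\nu_1\times\dots\times\nu_n$ of probability measures with $\nu\ll\mu$, let $m(\nu)=(m(\nu_1),\dots,m(\nu_n))$, where $m(\nu_i)\in V_i$ is the mean of $\nu_i$, i.e. the unique point with $\int h\,d\nu_i=h(m(\nu_i))$ for all bounded linear functionals $h$ on $V_i$; and let $D(\nu_i\|\mu_i)=\int\log\frac{d\nu_i}{d\mu_i}\,d\nu_i\in[0,\infty]$ be the Kullback–Leibler divergence. Then the maximum $$\Phi:=\max_{\nu\ll\mu,\ \nu=\nu_1\times\dots\times\nu_n}\Big\{f(m(\nu))-\sum_{i=1}^n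 D(\nu_i\|\mu_i)\Big\}$$ is attained and finite, $e^{f}$ is $\mu$-integrable on $W$, and $$\log\int_W e^{f(x)}\,d\mu(x)\le \Phi+B_1+B_2+\log 2+\log|\mathcal D(\epsilon)|,$$ where $$B_1=4\Big(M^2\Big(a\sum_{i=1}^n c_{ii}+\sum_{i=1}^n b_i^2\Big)+M^3\sum_{i,j=1}^n b_ic_{ij}+M^4\Big(a\sum_{i,j=1}^n c_{ij}^2+\sum_{i,j=1}^n b_ib_jc_{ij}\Big)\Big)^{1/2},$$ $$B_2=4\Big(\sum_{i=1}^n b_i^2+\epsilon^2n\Big)^{1/2}\Big(M^3\Big(\sum_{i=1}^n c_{ii}^2\Big)^{1/2}+M^2n^{1/2}\epsilon\Big)+\sum_{i=1}^nM^2c_{ii}+Mn\epsilon.$$ Moreover, $$\log\int_W e^{f(x)}\,d\mu(x)\ge \Phi-\frac{M^2}{2}\sum_{i=1}^n c_{ii}.$$ -/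

import Mathlib

open MeasureTheory

noncomputable section

namespace MeanField

/-- The mean `m(ν)` of a probability measure on a Banach space, as a Bochner integral.
`MeanField.mean_spec` and `MeanField.mean_unique` show that, for a measure carried by a compact
set, it is the unique point `m` with `∫ h dν = h m` for every bounded linear functional `h`. -/
def mean {E : Type*} [NormedAddCommGroup E] [NormedSpace ℝ E] [MeasurableSpace E]
    (ν : Measure E) : E :=
  ∫ z, z ∂ν

theorem integrable_id_of_isCompact {E : Type*} [NormedAddCommGroup E] [MeasurableSpace E]
    [BorelSpace E] {ν : Measure E} [IsProbabilityMeasure ν] {K : Set E} (hK : IsCompact K)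
    (hν : ν K = 1) : Integrable (fun z : E => z) ν := by
  have h : IntegrableOn (fun z : E => z) K ν :=
    continuousOn_id.integrableOn_compact hK
  have hr : ν.restrict K = ν :=
    Measure.restrict_eq_self_of_ae_mem
      ((prob_compl_eq_zero_iff hK.measurableSet).mpr hν)
  rwa [IntegrableOn, hr] at h

theorem mean_spec {E : Type*} [NormedAddCommGroup E] [NormedSpace ℝ E] [CompleteSpace E]
    [MeasurableSpace E] [BorelSpace E] {ν : Measure E} [IsProbabilityMeasure ν] {K : Set E}
    (hK : IsCompact K) (hν : ν K = 1) (h : E →L[ℝ] ℝ) :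
    Integrable h ν ∧ ∫ z, h z ∂ν = h (mean ν) :=
  ⟨h.integrable_comp (integrable_id_of_isCompact hK hν),
    h.integral_comp_comm (integrable_id_of_isCompact hK hν)⟩

theorem mean_unique {E : Type*} [NormedAddCommGroup E] [NormedSpace ℝ E] [CompleteSpace E]
    [MeasurableSpace E] [BorelSpace E] {ν : Measure E} [IsProbabilityMeasure ν] {K : Set E}
    (hK : IsCompact K) (hν : ν K = 1) (m : E)
    (hm : ∀ h : E →L[ℝ] ℝ, ∫ z, h z ∂ν = h m) : m = mean ν := by
  refine (SeparatingDual.eq_iff_forall_dual_eq (R := ℝ)).mpr fun h => ?_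
  rw [← hm h, (mean_spec hK hν h).2]

variable {n : ℕ} {V : Fin n → Type*} [∀ i, NormedAddCommGroup (V i)] [∀ i, NormedSpace ℝ (V i)]

/-- The partial differential `f_i(x) : V_i → ℝ`, that is `f_i(x)(r) = f'(x)(0, …, r, …, 0)`.
The product `∀ i, V i` carries the maximum norm. -/
def partialDeriv (f : (∀ i, V i) → ℝ) (i : Fin n) (x : ∀ i, V i) : V i →L[ℝ] ℝ :=
  (fderiv ℝ f x).comp (ContinuousLinearMap.single ℝ V i)

/-- The second partial differential `f_ij(x)(z, r)`: the derivative at `x` of `y ↦ f_i(y)(z)`,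
applied to `(0, …, r, …, 0)` with `r` in position `j`. -/
def partialDeriv₂ (f : (∀ i, V i) → ℝ) (i j : Fin n) (x : ∀ i, V i) (z : V i) (r : V j) : ℝ :=
  fderiv ℝ (fun y => partialDeriv f i y z) x (Pi.single j r)

/-- `f` is Fréchet differentiable on the whole product, and so is `x ↦ f_i(x)(z)` for every `i`
and every `z`. -/
def TwiceFrechetDifferentiable (f : (∀ i, V i) → ℝ) : Prop :=
  Differentiable ℝ f ∧ ∀ (i : Fin n) (z : V i), Differentiable ℝ (fun x => partialDeriv f i x z)

/-- The values `f(m(ν)) - ∑ i, D(ν_i ‖ μ_i)`, where `ν = ν_1 × … × ν_n` runs over the products of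
probability measures with `ν ≪ μ = μ_1 × … × μ_n`. A value is `-∞` if some divergence is infinite.
-/
def meanFieldValues [∀ i, MeasurableSpace (V i)] (μ : ∀ i, Measure (V i))
    (f : (∀ i, V i) → ℝ) : Set EReal :=
  {v | ∃ ν : ∀ i, Measure (V i), (∀ i, IsProbabilityMeasure (ν i)) ∧
    Measure.pi ν ≪ Measure.pi μ ∧
    v = (f (fun i => mean (ν i)) : EReal) -
      ((∑ i, InformationTheory.klDiv (ν i) (μ i) : ENNReal) : EReal)}

/-- The error term `B_1`. -/
def errorB₁ (M a : ℝ) (b : Fin n → ℝ) (c : Fin n → Fin n → ℝ) : ℝ :=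
  4 * Real.sqrt
    (M ^ 2 * (a * ∑ i, c i i + ∑ i, b i ^ 2)
      + M ^ 3 * ∑ i, ∑ j, b i * c i j
      + M ^ 4 * (a * ∑ i, ∑ j, c i j ^ 2 + ∑ i, ∑ j, b i * b j * c i j))

/-- The error term `B_2`. -/
def errorB₂ (M ε : ℝ) (b : Fin n → ℝ) (c : Fin n → Fin n → ℝ) : ℝ :=
  4 * Real.sqrt (∑ i, b i ^ 2 + ε ^ 2 * n)
      * (M ^ 3 * Real.sqrt (∑ i, c i i ^ 2) + M ^ 2 * Real.sqrt n * ε)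
    + ∑ i, M ^ 2 * c i i + M * n * ε

end MeanField

end

/-!
The two bounds compare `log ∫ e^f dμ` with the values `f(m(ν)) - ∑ i, D(ν i ‖ μ i)`.

*Lower bound.* Given `ν` with finite divergences and means `m i`, the coordinates are integrated out
one at a time. In each coordinate the Gibbs variational inequality bounds `log ∫ e^φ dμ i` from below
by `∫ φ dν i - D(ν i ‖ μ i)`, and a second order Taylor expansion of `φ` at `m i`, whose linear part
has `ν i`-mean zero, costs at most `M² c i i / 2`
(`BoundedSetting.sub_toReal_klDiv_le_log_integral_update`).

*Upper bound.* Let `x̂ i` be the conditional mean of the `i`-th coordinate under the Gibbs measure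
proportional to `e^f dμ`, given the other coordinates of `x`, and let
`k x = f x - f x̂ - ∑ i, f_i(x)(x i - x̂ i)` (`linearizationError`). Two facts suffice.

* The Gibbs expectation of `k` is at most `B₁ + ∑ i, M² c i i`. The difference `f x - f x̂`
  telescopes over the coordinates. The `i`-th increment is linear in `x i - x̂ i` up to second order,
  with a slope that hardly depends on `x i`, and the linear part has conditional mean zero; in the
  same way `f_i(x)(x i - x̂ i)` has small expectation. This bounds the expectation of `f x - f x̂` by
  `Q = M² ∑ c i i + M⁴ ∑ c i j ²`; since it is also at most `2 a`, it is at most `√(2 a Q) ≤ B₁`.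
* Pointwise, if `d ∈ D` is close to the partial differentials at `x` and `p i` is the mean of the
  tilt of `μ i` by `d i`, then `f x - k x` exceeds `f p + ∑ i, d i (x i - p i)` by at most
  `B₂ - ∑ i, M² c i i`. The measures with means `x̂ i` and `p i` are tilts of `μ i` by functions whose
  difference has small oscillation, so `x̂ i` is close to `p i` (`norm_integral_tilted_sub_le`).
  Up to the value of the variational problem at these tilts, `∑ i, d i (x i - p i)` is the logarithm
  of their product density.

With `Φ` the value of the variational problem, summing the product densities over `D` gives
`∫ e^(f - k) dμ ≤ |D| e^(Φ + B₂ - ∑ i, M² c i i)`, while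
Jensen's inequality gives `∫ e^(f - k) dμ ≥ e^(-E k) ∫ e^f dμ`.

*The maximum is attained.* Along a maximising sequence the means and divergences subconverge. In each
coordinate, densities that nearly minimise the entropy among those with mean close to the limit are
Cauchy in `L¹`, because `x log x` is uniformly convex with respect to the Hellinger distance
(`half_sq_sqrt_sub_sqrt_le`), and Fatou's lemma passes the entropy to the limit
(`exists_isEntropyDensity_of_tendsto`). No weak compactness of measures is needed.
-/

noncomputable section

namespace MeanField

open Set Function Filter Topology InformationTheory

/-! ### Increments of twice differentiable functions on a product -/

section Calculus

variable {n : ℕ} {V : Fin n → Type*} [∀ i, NormedAddCommGroup (V i)] [∀ i, NormedSpace ℝ (V i)]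
  {W : ∀ i, Set (V i)} {f : (∀ i, V i) → ℝ} {b : Fin n → ℝ} {c : Fin n → Fin n → ℝ}

theorem update_mem_univ_pi {ι : Type*} [DecidableEq ι] {X : ι → Type*} {W : ∀ i, Set (X i)}
    {x : ∀ i, X i} (hx : x ∈ univ.pi W) {i : ι} {z : X i} (hz : z ∈ W i) :
    update x i z ∈ univ.pi W :=
  update_mem_pi_iff_of_mem hx |>.mpr fun _ => hz

theorem fderiv_eq_sum_partialDeriv (x v : ∀ i, V i) :
    fderiv ℝ f x v = ∑ i, partialDeriv f i x (v i) := by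
  conv_lhs => rw [← Finset.univ_sum_single v, map_sum]
  rfl

theorem fderiv_partialDeriv_eq_sum (i : Fin n) (x : ∀ i, V i) (z : V i) (v : ∀ i, V i) :
    fderiv ℝ (fun y => partialDeriv f i y z) x v = ∑ j, partialDeriv₂ f i j x z (v j) := by
  conv_lhs => rw [← Finset.univ_sum_single v, map_sum]
  rfl

/-- The bound on the unit ball extends to all vectors, because `f_ij(x)` is bilinear. -/
theorem abs_partialDeriv₂_le (hf : TwiceFrechetDifferentiable f) {x : ∀ i, V i} {i j : Fin n}
    {C : ℝ} (hC : ∀ (z : V i) (r : V j), max ‖r‖ ‖z‖ ≤ 1 → |partialDeriv₂ f i j x z r| ≤ C)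
    (z : V i) (r : V j) : |partialDeriv₂ f i j x z r| ≤ C * ‖z‖ * ‖r‖ := by
  have hsmul : ∀ (s t : ℝ) (z : V i) (r : V j),
      partialDeriv₂ f i j x (s • z) (t • r) = s * t * partialDeriv₂ f i j x z r := by
    intro s t z r
    have h1 : (fun y => partialDeriv f i y (s • z)) = fun y => s • partialDeriv f i y z := by
      ext y; simp
    unfold partialDeriv₂
    rw [h1, fderiv_fun_const_smul (hf.2 i z x), Pi.single_smul, map_smul]
    simp only [smul_apply, smul_eq_mul]
    ring
  rcases eq_or_ne z 0 with rfl | hz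
  · have := hsmul 0 1 0 r
    simp only [zero_smul, one_smul, zero_mul] at this
    simp [this]
  rcases eq_or_ne r 0 with rfl | hr
  · have := hsmul 1 0 z 0
    simp only [smul_zero, one_smul, mul_zero, zero_mul] at this
    simp [this]
  have hz' := norm_pos_iff.mpr hz
  have hr' := norm_pos_iff.mpr hr
  have h := hC (‖z‖⁻¹ • z) (‖r‖⁻¹ • r) (by
    rw [norm_smul, norm_smul, norm_inv, norm_inv, norm_norm, norm_norm,
      inv_mul_cancel₀ hz'.ne', inv_mul_cancel₀ hr'.ne', max_self])
  rw [hsmul, abs_mul, abs_of_pos (by positivity)] at h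
  calc |partialDeriv₂ f i j x z r|
      = (‖z‖⁻¹ * ‖r‖⁻¹ * |partialDeriv₂ f i j x z r|) * ‖z‖ * ‖r‖ := by field_simp
    _ ≤ C * ‖z‖ * ‖r‖ := by gcongr

theorem lineMap_mem_univ_pi (hW : ∀ i, Convex ℝ (W i)) {x y : ∀ i, V i} (hx : x ∈ univ.pi W)
    (hy : y ∈ univ.pi W) {t : ℝ} (ht : t ∈ Icc (0 : ℝ) 1) : y + t • (x - y) ∈ univ.pi W :=
  (convex_pi fun i _ => hW i).add_smul_sub_mem hy hx ht

theorem hasDerivAt_add_smul_sub {E : Type*} [NormedAddCommGroup E] [NormedSpace ℝ E] {g : E → ℝ}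
    (hg : Differentiable ℝ g) (x y : E) (t : ℝ) :
    HasDerivAt (fun t : ℝ => g (y + t • (x - y))) (fderiv ℝ g (y + t • (x - y)) (x - y)) t := by
  have h : HasDerivAt (fun t : ℝ => y + t • (x - y)) (x - y) t := by
    simpa using ((hasDerivAt_id t).smul_const (x - y)).const_add y
  exact (hg _).hasFDerivAt.comp_hasDerivAt t h

/-- Mean value inequality along a segment. -/
theorem abs_sub_le_of_fderiv_segment {E : Type*} [NormedAddCommGroup E] [NormedSpace ℝ E]
    {g : E → ℝ} (hg : Differentiable ℝ g) (x y : E) {C : ℝ}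
    (hC : ∀ t ∈ Icc (0 : ℝ) 1, |fderiv ℝ g (y + t • (x - y)) (x - y)| ≤ C) :
    |g x - g y| ≤ C := by
  have h := norm_image_sub_le_of_norm_deriv_le_segment_01' (C := C)
    (fun t _ => (hasDerivAt_add_smul_sub hg x y t).hasDerivWithinAt)
    (fun t ht => hC t (Ico_subset_Icc_self ht))
  simpa using h

theorem abs_sub_le_sum_of_partialDeriv_le (hf : TwiceFrechetDifferentiable f)
    (hW : ∀ i, Convex ℝ (W i)) (hfb : ∀ x ∈ univ.pi W, ∀ i, ‖partialDeriv f i x‖ ≤ b i)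
    {x y : ∀ i, V i} (hx : x ∈ univ.pi W) (hy : y ∈ univ.pi W) :
    |f x - f y| ≤ ∑ i, b i * ‖x i - y i‖ := by
  refine abs_sub_le_of_fderiv_segment hf.1 x y fun t ht => ?_
  rw [fderiv_eq_sum_partialDeriv]
  refine (Finset.abs_sum_le_sum_abs _ _).trans (Finset.sum_le_sum fun i _ => ?_)
  exact (partialDeriv f i _).le_of_opNorm_le (hfb _ (lineMap_mem_univ_pi hW hx hy ht) i) _

theorem norm_partialDeriv_sub_le (hf : TwiceFrechetDifferentiable f)
    (hW : ∀ i, Convex ℝ (W i)) (hc : ∀ i j, 0 < c i j)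
    (hfc : ∀ x ∈ univ.pi W, ∀ i j, ∀ (z : V i) (r : V j), max ‖r‖ ‖z‖ ≤ 1 →
      |partialDeriv₂ f i j x z r| ≤ c i j)
    {x y : ∀ i, V i} (hx : x ∈ univ.pi W) (hy : y ∈ univ.pi W) (i : Fin n) :
    ‖partialDeriv f i x - partialDeriv f i y‖ ≤ ∑ j, c i j * ‖x j - y j‖ := by
  refine ContinuousLinearMap.opNorm_le_bound _
    (Finset.sum_nonneg fun j _ => mul_nonneg (hc i j).le (norm_nonneg _)) fun z => ?_
  refine abs_sub_le_of_fderiv_segment (hf.2 i z) x y fun t ht => ?_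
  rw [fderiv_partialDeriv_eq_sum, Finset.sum_mul]
  refine (Finset.abs_sum_le_sum_abs _ _).trans (Finset.sum_le_sum fun j _ => ?_)
  refine (abs_partialDeriv₂_le hf (hfc _ (lineMap_mem_univ_pi hW hx hy ht) i j) z _).trans
    (le_of_eq ?_)
  simp only [Pi.sub_apply]; ring

theorem hasDerivAt_update_segment (hf : TwiceFrechetDifferentiable f) (x : ∀ i, V i) (i : Fin n)
    (z z' : V i) (t : ℝ) :
    HasDerivAt (fun t : ℝ => f (update x i (z' + t • (z - z'))))
      (partialDeriv f i (update x i (z' + t • (z - z'))) (z - z')) t := by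
  have h : ∀ t : ℝ, update x i (z' + t • (z - z'))
      = update x i z' + t • (update x i z - update x i z') := by
    intro t
    ext j
    rcases eq_or_ne j i with rfl | hj
    · simp
    · simp [hj]
  have h2 : update x i z - update x i z' = Pi.single i (z - z') := by
    ext j
    rcases eq_or_ne j i with rfl | hj
    · simp
    · simp [hj]
  have h3 := hasDerivAt_add_smul_sub hf.1 (update x i z) (update x i z') t
  simp only [← h] at h3
  rw [h2] at h3
  exact h3

/-- Second order Taylor estimate in one coordinate. -/
theorem abs_update_sub_update_sub_le (hf : TwiceFrechetDifferentiable f)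
    (hW : ∀ i, Convex ℝ (W i)) (hc : ∀ i j, 0 < c i j)
    (hfc : ∀ x ∈ univ.pi W, ∀ i j, ∀ (z : V i) (r : V j), max ‖r‖ ‖z‖ ≤ 1 →
      |partialDeriv₂ f i j x z r| ≤ c i j)
    {x : ∀ i, V i} (hx : x ∈ univ.pi W) {i : Fin n} {z z' : V i} (hz : z ∈ W i)
    (hz' : z' ∈ W i) :
    |f (update x i z) - f (update x i z') - partialDeriv f i (update x i z') (z - z')|
      ≤ c i i / 2 * ‖z - z'‖ ^ 2 := by
  have hd : ∀ t : ℝ, HasDerivAt (fun t : ℝ => f (update x i (z' + t • (z - z'))) - f (update x i z')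
      - t * partialDeriv f i (update x i z') (z - z'))
      (partialDeriv f i (update x i (z' + t • (z - z'))) (z - z')
        - partialDeriv f i (update x i z') (z - z')) t := by
    intro t
    have h := ((hasDerivAt_update_segment hf x i z z' t).sub_const (f (update x i z'))).fun_sub
      ((hasDerivAt_id' t).mul_const (partialDeriv f i (update x i z') (z - z')))
    rwa [one_mul] at h
  have hB : ∀ t : ℝ, HasDerivAt (fun t : ℝ => c i i / 2 * ‖z - z'‖ ^ 2 * t ^ 2)
      (c i i * ‖z - z'‖ ^ 2 * t) t := by
    intro t
    convert! (hasDerivAt_pow 2 t).const_mul (c i i / 2 * ‖z - z'‖ ^ 2) using 1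
    push_cast; ring
  have h := image_norm_le_of_norm_deriv_right_le_deriv_boundary (a := 0) (b := 1)
    (fun t _ => (hd t).continuousAt.continuousWithinAt)
    (fun t _ => (hd t).hasDerivWithinAt) (B := fun t => c i i / 2 * ‖z - z'‖ ^ 2 * t ^ 2)
    (by simp) hB (fun t ht => ?_) (right_mem_Icc.mpr zero_le_one)
  · simpa using h
  · have hzt : z' + t • (z - z') ∈ W i :=
      (hW i).add_smul_sub_mem hz' hz (Ico_subset_Icc_self ht)
    have h1 := norm_partialDeriv_sub_le hf hW hc hfc (update_mem_univ_pi hx hzt)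
      (update_mem_univ_pi hx hz') i
    rw [Finset.sum_eq_single i (fun j _ hj => by simp [hj]) (by simp)] at h1
    simp only [update_self, add_sub_cancel_left, norm_smul, Real.norm_eq_abs,
      abs_of_nonneg ht.1] at h1
    rw [← sub_apply]
    refine (ContinuousLinearMap.le_of_opNorm_le _ h1 _).trans (le_of_eq (by ring))

/-- Comparison of an increment of `f` in the `i`-th coordinate with a continuous linear
functional close to the partial differentials. -/
theorem abs_update_sub_update_sub_apply_le (hf : TwiceFrechetDifferentiable f)
    (hW : ∀ i, Convex ℝ (W i)) {x : ∀ i, V i} {i : Fin n} {z z' : V i}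
    (hz : z ∈ W i) (hz' : z' ∈ W i) (L : V i →L[ℝ] ℝ) {C : ℝ}
    (hC : ∀ w ∈ W i, ‖partialDeriv f i (update x i w) - L‖ ≤ C) :
    |f (update x i z) - f (update x i z') - L (z - z')| ≤ C * ‖z - z'‖ := by
  have hd : ∀ t : ℝ, HasDerivAt (fun t : ℝ => f (update x i (z' + t • (z - z')))
      - t * L (z - z'))
      (partialDeriv f i (update x i (z' + t • (z - z'))) (z - z') - L (z - z')) t := by
    intro t
    have h := (hasDerivAt_update_segment hf x i z z' t).fun_sub
      ((hasDerivAt_id' t).mul_const (L (z - z')))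
    rwa [one_mul] at h
  have h := norm_image_sub_le_of_norm_deriv_le_segment_01' (C := C * ‖z - z'‖)
    (fun t _ => (hd t).hasDerivWithinAt) (fun t ht => by
      rw [← sub_apply]
      exact ContinuousLinearMap.le_of_opNorm_le _
        (hC _ ((hW i).add_smul_sub_mem hz' hz (Ico_subset_Icc_self ht))) _)
  simp only [one_smul, add_sub_cancel, one_mul, zero_smul, add_zero, zero_mul, sub_zero,
    Real.norm_eq_abs] at h
  convert! h using 2
  ring

/-- Mixed second difference: the increment of `f` in the `i`-th coordinate depends on the base
point through the other coordinates only. -/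
theorem abs_update_sub_update_sub_update_sub_update_le (hf : TwiceFrechetDifferentiable f)
    (hW : ∀ i, Convex ℝ (W i)) (hc : ∀ i j, 0 < c i j)
    (hfc : ∀ x ∈ univ.pi W, ∀ i j, ∀ (z : V i) (r : V j), max ‖r‖ ‖z‖ ≤ 1 →
      |partialDeriv₂ f i j x z r| ≤ c i j)
    {x y : ∀ i, V i} (hx : x ∈ univ.pi W) (hy : y ∈ univ.pi W) {i : Fin n} {z z' : V i}
    (hz : z ∈ W i) (hz' : z' ∈ W i) :
    |f (update x i z) - f (update x i z') - (f (update y i z) - f (update y i z'))|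
      ≤ (∑ j ∈ Finset.univ.erase i, c i j * ‖x j - y j‖) * ‖z - z'‖ := by
  have hd : ∀ t : ℝ, HasDerivAt (fun t : ℝ => f (update x i (z' + t • (z - z')))
      - f (update y i (z' + t • (z - z')))) _ t := fun t =>
    (hasDerivAt_update_segment hf x i z z' t).sub (hasDerivAt_update_segment hf y i z z' t)
  have h := norm_image_sub_le_of_norm_deriv_le_segment_01'
    (C := (∑ j ∈ Finset.univ.erase i, c i j * ‖x j - y j‖) * ‖z - z'‖)
    (fun t _ => (hd t).hasDerivWithinAt) (fun t ht => by
      rw [← sub_apply]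
      have hzt : z' + t • (z - z') ∈ W i :=
        (hW i).add_smul_sub_mem hz' hz (Ico_subset_Icc_self ht)
      refine ContinuousLinearMap.le_of_opNorm_le _ ?_ _
      refine (norm_partialDeriv_sub_le hf hW hc hfc (update_mem_univ_pi hx hzt)
        (update_mem_univ_pi hy hzt) i).trans (le_of_eq ?_)
      rw [← Finset.add_sum_erase _ _ (Finset.mem_univ i)]
      simp only [update_self, sub_self, norm_zero, mul_zero, zero_add]
      refine Finset.sum_congr rfl fun j hj => ?_
      simp [Finset.ne_of_mem_erase hj])
  simp only [one_smul, add_sub_cancel, zero_smul, add_zero, Real.norm_eq_abs] at h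
  convert! h using 2
  ring

end Calculus

/-! ### Exponential tilts with close log-densities -/

section Tilting

variable {α : Type*} [MeasurableSpace α] {μ : Measure α} [IsProbabilityMeasure μ]
  {E : Type*} [NormedAddCommGroup E] [NormedSpace ℝ E] [CompleteSpace E]

theorem integrable_exp_of_ae_abs_le {g : α → ℝ} (hg : AEMeasurable g μ) {C : ℝ}
    (hC : ∀ᵐ z ∂μ, |g z| ≤ C) : Integrable (fun z => Real.exp (g z)) μ := by
  refine Integrable.of_bound (Real.measurable_exp.comp_aemeasurable hg).aestronglyMeasurable
    (Real.exp C) ?_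
  filter_upwards [hC] with z hz
  rw [Real.norm_eq_abs, Real.abs_exp]
  exact Real.exp_le_exp.mpr ((le_abs_self _).trans hz)

theorem integrable_tilted_of_bound {F : Type*} [NormedAddCommGroup F] {g : α → ℝ} {T : α → F}
    (hT : AEStronglyMeasurable T μ) {s : Set α} (hs : ∀ᵐ z ∂μ, z ∈ s) {R : ℝ}
    (hR : ∀ z ∈ s, ‖T z‖ ≤ R) : Integrable T (μ.tilted g) := by
  by_cases hg : Integrable (fun z => Real.exp (g z)) μ
  · have := isProbabilityMeasure_tilted hg
    refine Integrable.of_bound (hT.mono_ac (tilted_absolutelyContinuous μ g)) R ?_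
    filter_upwards [(tilted_absolutelyContinuous μ g).ae_le hs] with z hz using hR z hz
  · rw [tilted_of_not_integrable hg]
    exact integrable_zero_measure

theorem norm_sub_integral_le {ν : Measure α} [IsProbabilityMeasure ν] {T : α → E}
    (hT : Integrable T ν) {s : Set α} (hs : ∀ᵐ z ∂ν, z ∈ s) {M : ℝ} {w : E}
    (hM : ∀ z ∈ s, ‖w - T z‖ ≤ M) : ‖w - ∫ z, T z ∂ν‖ ≤ M := by
  have h : w - ∫ z, T z ∂ν = ∫ z, (w - T z) ∂ν := by
    rw [integral_sub (integrable_const _) hT]; simp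
  rw [h]
  have := norm_integral_le_of_norm_le_const (μ := ν) (hs.mono hM)
  simpa using this

/-- Two tilts of `μ` by functions whose difference oscillates by at most `s` have mean values of
`T` within `M * s`, if `T` oscillates by at most `M`: the second tilt dominates `1 - s` times the
first one. -/
theorem norm_integral_tilted_sub_le {T : α → E} (hT : AEStronglyMeasurable T μ)
    {g₀ g₁ : α → ℝ} (hg₀ : AEMeasurable g₀ μ) (hg₁ : AEMeasurable g₁ μ)
    {S : Set α} (hS : ∀ᵐ z ∂μ, z ∈ S) {C M s : ℝ}
    (h₀ : ∀ z ∈ S, |g₀ z| ≤ C) (h₁ : ∀ z ∈ S, |g₁ z| ≤ C)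
    (hM : ∀ z ∈ S, ∀ z' ∈ S, ‖T z - T z'‖ ≤ M)
    (hs : ∀ z ∈ S, ∀ z' ∈ S, |g₁ z - g₀ z - (g₁ z' - g₀ z')| ≤ s) :
    ‖∫ z, T z ∂(μ.tilted g₁) - ∫ z, T z ∂(μ.tilted g₀)‖ ≤ M * s := by
  have hi₀ := integrable_exp_of_ae_abs_le hg₀ (hS.mono h₀)
  have hi₁ := integrable_exp_of_ae_abs_le hg₁ (hS.mono h₁)
  have := isProbabilityMeasure_tilted hi₀
  have := isProbabilityMeasure_tilted hi₁
  obtain ⟨z₀, hz₀⟩ := hS.exists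
  have hR : ∀ z ∈ S, ‖T z‖ ≤ M + ‖T z₀‖ := fun z hz => by
    calc ‖T z‖ = ‖(T z - T z₀) + T z₀‖ := by simp
      _ ≤ _ := (norm_add_le _ _).trans (by gcongr; exact hM z hz z₀ hz₀)
  have hT₀ : Integrable T (μ.tilted g₀) := integrable_tilted_of_bound hT hS hR
  have hT₁ : Integrable T (μ.tilted g₁) := integrable_tilted_of_bound hT hS hR
  set m₀ := ∫ z, T z ∂(μ.tilted g₀) with hm₀
  set Z₀ := ∫ z, Real.exp (g₀ z) ∂μ
  set Z₁ := ∫ z, Real.exp (g₁ z) ∂μ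
  have hZ₀ : 0 < Z₀ := integral_exp_pos hi₀
  have hZ₁ : 0 < Z₁ := integral_exp_pos hi₁
  have hS₀ : ∀ᵐ z ∂(μ.tilted g₀), z ∈ S := (tilted_absolutelyContinuous μ g₀).ae_le hS
  -- the density of the second tilt is at least `exp (-s) ≥ 1 - s` times that of the first
  have hdens : ∀ z ∈ S, (1 - s) * (Real.exp (g₀ z) / Z₀) ≤ Real.exp (g₁ z) / Z₁ := by
    intro z hz
    have hZ : Z₁ ≤ Real.exp (g₁ z - g₀ z + s) * Z₀ := by
      rw [← integral_const_mul]
      refine integral_mono_ae hi₁ (hi₀.const_mul _) ?_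
      filter_upwards [hS] with z' hz'
      rw [← Real.exp_add]
      refine Real.exp_le_exp.mpr ?_
      have := (abs_le.mp (hs z hz z' hz')).1
      linarith
    have h1 : Real.exp (-s) * (Real.exp (g₀ z) / Z₀) ≤ Real.exp (g₁ z) / Z₁ := by
      rw [← mul_div_assoc, div_le_div_iff₀ hZ₀ hZ₁]
      calc Real.exp (-s) * Real.exp (g₀ z) * Z₁
          ≤ Real.exp (-s) * Real.exp (g₀ z) * (Real.exp (g₁ z - g₀ z + s) * Z₀) := by gcongr
        _ = Real.exp (g₁ z) * Z₀ := by
            rw [← mul_assoc, ← Real.exp_add, ← Real.exp_add]; congr 2; ring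
    refine le_trans ?_ h1
    gcongr
    linarith [Real.add_one_le_exp (-s)]
  have hc₀ : ∫ z, (T z - m₀) ∂(μ.tilted g₀) = 0 := by
    rw [integral_sub hT₀ (integrable_const _)]; simp [hm₀]
  have hc₁ : ∫ z, (T z - m₀) ∂(μ.tilted g₁) = ∫ z, T z ∂(μ.tilted g₁) - m₀ := by
    rw [integral_sub hT₁ (integrable_const _)]; simp
  have hI₀ : Integrable (fun z => (Real.exp (g₀ z) / Z₀) • (T z - m₀)) μ := by
    have := (integrable_tilted_iff hi₀ _).mp (hT₀.sub (integrable_const m₀))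
    refine (this.smul Z₀⁻¹).congr (ae_of_all _ fun z => ?_)
    simp only [Pi.smul_apply, smul_smul, Pi.sub_apply]; congr 1; ring
  have hI₁ : Integrable (fun z => (Real.exp (g₁ z) / Z₁) • (T z - m₀)) μ := by
    have := (integrable_tilted_iff hi₁ _).mp (hT₁.sub (integrable_const m₀))
    refine (this.smul Z₁⁻¹).congr (ae_of_all _ fun z => ?_)
    simp only [Pi.smul_apply, smul_smul, Pi.sub_apply]; congr 1; ring
  have key : ∫ z, T z ∂(μ.tilted g₁) - m₀ =
      ∫ z, (Real.exp (g₁ z) / Z₁ - (1 - s) * (Real.exp (g₀ z) / Z₀)) • (T z - m₀) ∂μ := by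
    simp_rw [sub_smul, mul_smul]
    rw [integral_sub hI₁ (hI₀.fun_smul (1 - s)), integral_smul, ← integral_tilted g₀,
      ← integral_tilted g₁, hc₀, hc₁, smul_zero, sub_zero]
  rw [key]
  have hp₀ : ∫ z, Real.exp (g₀ z) / Z₀ ∂μ = 1 := by
    rw [integral_div]; exact div_self hZ₀.ne'
  have hp₁ : ∫ z, Real.exp (g₁ z) / Z₁ ∂μ = 1 := by
    rw [integral_div]; exact div_self hZ₁.ne'
  have hint := (hi₁.div_const Z₁).sub ((hi₀.div_const Z₀).const_mul (1 - s))
  calc _ ≤ ∫ z, (Real.exp (g₁ z) / Z₁ - (1 - s) * (Real.exp (g₀ z) / Z₀)) * M ∂μ := by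
        refine norm_integral_le_of_norm_le (hint.mul_const M) ?_
        filter_upwards [hS] with z hz
        rw [norm_smul, Real.norm_of_nonneg (sub_nonneg.mpr (hdens z hz))]
        gcongr
        · exact sub_nonneg.mpr (hdens z hz)
        · exact norm_sub_integral_le hT₀ hS₀ (hM z hz)
    _ = M * s := by
        rw [integral_mul_const, integral_sub (hi₁.div_const Z₁)
          ((hi₀.div_const Z₀).const_mul (1 - s)), integral_const_mul, hp₀, hp₁]
        ring

end Tilting

/-! ### Products of probability measures -/

section Product

variable {ι : Type*} [Fintype ι] [DecidableEq ι] {X : ι → Type*} [∀ i, MeasurableSpace (X i)]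
  (μ : ∀ i, Measure (X i)) [∀ i, IsProbabilityMeasure (μ i)]

/-- Resampling one coordinate preserves a product of probability measures. -/
theorem measurePreserving_update (i : ι) :
    MeasurePreserving (fun p : (∀ j, X j) × X i => update p.1 i p.2)
      ((Measure.pi μ).prod (μ i)) (Measure.pi μ) := by
  have hm : Measurable (fun p : (∀ j, X j) × X i => update p.1 i p.2) := by
    refine measurable_pi_lambda _ fun j => ?_
    rcases eq_or_ne j i with rfl | hj
    · simpa using measurable_snd
    · simp only [update_of_ne hj]
      exact (measurable_pi_apply j).comp measurable_fst
  refine ⟨hm, (Measure.pi_eq fun s hs => ?_).symm⟩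
  rw [Measure.map_apply hm (MeasurableSet.univ_pi hs)]
  have h : (fun p : (∀ j, X j) × X i => update p.1 i p.2) ⁻¹' univ.pi s
      = (univ.pi (update s i univ)) ×ˢ s i := by
    ext p
    simp only [mem_preimage, mem_univ_pi, mem_prod]
    constructor
    · intro hp
      refine ⟨fun j => ?_, by simpa using hp i⟩
      rcases eq_or_ne j i with rfl | hj
      · simp
      · simpa [hj] using hp j
    · rintro ⟨h1, h2⟩ j
      rcases eq_or_ne j i with rfl | hj
      · simpa using h2
      · simpa [hj] using h1 j
  rw [h, Measure.prod_prod, Measure.pi_pi, ← Finset.mul_prod_erase _ _ (Finset.mem_univ i),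
    ← Finset.mul_prod_erase _ (fun j => μ j (s j)) (Finset.mem_univ i)]
  simp only [update_self, measure_univ, one_mul]
  rw [mul_comm]
  congr 1
  exact Finset.prod_congr rfl fun j hj => by rw [update_of_ne (Finset.ne_of_mem_erase hj)]

theorem integral_pi_eq_integral_integral_update {φ : (∀ j, X j) → ℝ}
    (hφ : Integrable φ (Measure.pi μ)) (i : ι) :
    ∫ x, φ x ∂(Measure.pi μ) = ∫ x, ∫ z, φ (update x i z) ∂(μ i) ∂(Measure.pi μ) := by
  have hmp := measurePreserving_update μ i
  rw [← integral_prod (fun p : (∀ j, X j) × X i => φ (update p.1 i p.2))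
    (hmp.integrable_comp_of_integrable hφ)]
  conv_lhs => rw [← hmp.map_eq]
  rw [integral_map hmp.aemeasurable (by rw [hmp.map_eq]; exact hφ.1)]

theorem integrable_integral_update {φ : (∀ j, X j) → ℝ}
    (hφ : Integrable φ (Measure.pi μ)) (i : ι) :
    Integrable (fun x => ∫ z, φ (update x i z) ∂(μ i)) (Measure.pi μ) :=
  ((measurePreserving_update μ i).integrable_comp_of_integrable hφ).integral_prod_left

end Product

/-- The product of the Radon-Nikodym derivatives is a density of the product measure. -/
theorem pi_absolutelyContinuous_pi {ι : Type*} [Fintype ι] {X : ι → Type*}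
    [∀ i, MeasurableSpace (X i)] (μ : ∀ i, Measure (X i)) [∀ i, IsProbabilityMeasure (μ i)]
    {ν : ∀ i, Measure (X i)} [∀ i, IsProbabilityMeasure (ν i)]
    (h : ∀ i, ν i ≪ μ i) : Measure.pi ν ≪ Measure.pi μ := by
  have hint : Integrable (fun x : ∀ i, X i => ∏ i, ((ν i).rnDeriv (μ i) (x i)).toReal)
      (Measure.pi μ) := Integrable.fintype_prod_dep fun i => Measure.integrable_toReal_rnDeriv
  have key : Measure.pi ν = (Measure.pi μ).withDensity
      fun x => ENNReal.ofReal (∏ i, ((ν i).rnDeriv (μ i) (x i)).toReal) := by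
    refine Measure.pi_eq fun s hs => ?_
    have hnn : ∀ x : ∀ i, X i, 0 ≤ ∏ i, ((ν i).rnDeriv (μ i) (x i)).toReal := fun x =>
      Finset.prod_nonneg fun i _ => ENNReal.toReal_nonneg
    rw [withDensity_apply _ (MeasurableSet.univ_pi hs),
      ← ofReal_integral_eq_lintegral_ofReal hint.integrableOn (ae_of_all _ hnn),
      Measure.restrict_pi_pi, integral_fintype_prod_eq_prod
        (fun i z => ((ν i).rnDeriv (μ i) z).toReal),
      ENNReal.ofReal_prod_of_nonneg fun i _ => integral_nonneg fun z => ENNReal.toReal_nonneg]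
    refine Finset.prod_congr rfl fun i _ => ?_
    rw [Measure.setIntegral_toReal_rnDeriv (h i), ofReal_measureReal]
  rw [key]
  exact withDensity_absolutelyContinuous _ _

theorem ae_mem_univ_pi {ι : Type*} [Fintype ι] {X : ι → Type*} [∀ i, MeasurableSpace (X i)]
    (μ : ∀ i, Measure (X i)) [∀ i, IsProbabilityMeasure (μ i)] {W : ∀ i, Set (X i)}
    (hμW : ∀ i, ∀ᵐ z ∂(μ i), z ∈ W i) :
    ∀ᵐ x ∂(Measure.pi μ), x ∈ univ.pi W := by
  have : ∀ i, ∀ᵐ x ∂(Measure.pi μ), x i ∈ W i := fun i =>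
    (Measure.quasiMeasurePreserving_eval μ i).ae (hμW i)
  filter_upwards [ae_all_iff.mpr this] with x hx i _ using hx i

/-! ### Measurability on products of compact sets -/

/-- On a product of compact sets that carry the measures, continuous functions are almost
everywhere measurable for the product `σ`-algebra, although the latter can be smaller than the
Borel `σ`-algebra of a product of nonseparable spaces. -/
theorem aestronglyMeasurable_pi_of_continuousOn {ι : Type*} [Fintype ι]
    {X : ι → Type*} [∀ i, MetricSpace (X i)] [∀ i, MeasurableSpace (X i)] [∀ i, BorelSpace (X i)]
    (μ : ∀ i, Measure (X i)) [∀ i, IsProbabilityMeasure (μ i)] {W : ∀ i, Set (X i)}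
    (hW : ∀ i, IsCompact (W i)) (hμW : ∀ i, ∀ᵐ z ∂(μ i), z ∈ W i) {F : Type*}
    [TopologicalSpace F] [TopologicalSpace.PseudoMetrizableSpace F] {φ : (∀ i, X i) → F}
    (hφ : ContinuousOn φ (univ.pi W)) :
    AEStronglyMeasurable φ (Measure.pi μ) := by
  classical
  have : ∀ i, CompactSpace (W i) := fun i => isCompact_iff_compactSpace.mp (hW i)
  have hne : ∀ i, ∃ z, z ∈ W i := fun i => (hμW i).exists
  choose w hw using hne
  let ρ : (∀ i, X i) → ∀ i, W i := fun x i =>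
    if h : x i ∈ W i then ⟨x i, h⟩ else ⟨w i, hw i⟩
  have hρ : Measurable ρ := by
    refine measurable_pi_lambda _ fun i => ?_
    have h : Measurable fun z : X i => if h : z ∈ W i then (⟨z, h⟩ : W i) else ⟨w i, hw i⟩ :=
      Measurable.dite (s := W i) measurable_id measurable_const (hW i).measurableSet
    exact h.comp (measurable_pi_apply i)
  -- the product of the compact metric spaces `W i` carries its Borel `σ`-algebra
  have hc : Continuous fun k : ∀ i, W i => φ fun i => k i :=
    hφ.comp_continuous (by fun_prop) fun k i _ => (k i).2
  refine AEStronglyMeasurable.congr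
    (hc.stronglyMeasurable.comp_measurable hρ).aestronglyMeasurable ?_
  filter_upwards [ae_mem_univ_pi μ hμW] with x hx
  have : (fun i => (ρ x i : X i)) = x := by
    ext i
    simp [ρ, hx i (mem_univ i)]
  simp only [comp_apply, this]

theorem integrable_pi_of_continuousOn {ι : Type*} [Fintype ι]
    {X : ι → Type*} [∀ i, MetricSpace (X i)] [∀ i, MeasurableSpace (X i)] [∀ i, BorelSpace (X i)]
    (μ : ∀ i, Measure (X i)) [∀ i, IsProbabilityMeasure (μ i)] {W : ∀ i, Set (X i)}
    (hW : ∀ i, IsCompact (W i)) (hμW : ∀ i, ∀ᵐ z ∂(μ i), z ∈ W i) {φ : (∀ i, X i) → ℝ}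
    (hφ : ContinuousOn φ (univ.pi W)) : Integrable φ (Measure.pi μ) := by
  obtain ⟨C, hC⟩ := (isCompact_univ_pi hW).exists_bound_of_continuousOn hφ
  refine Integrable.of_bound (aestronglyMeasurable_pi_of_continuousOn μ hW hμW hφ) C ?_
  filter_upwards [ae_mem_univ_pi μ hμW] with x hx using hC x hx

/-! ### Closedness of the set of means and entropies -/

section EntropyClosure

/-- Tangent line bound for `x ↦ x log x`, with a Hellinger-type remainder. -/
theorem mul_log_add_two_mul_sub_le {x m : ℝ} (hx : 0 ≤ x) (hm : 0 < m) :
    x * Real.log m + 2 * x - 2 * (√x * √m) ≤ x * Real.log x := by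
  rcases hx.eq_or_lt with rfl | hx
  · simp
  have hsx := Real.sqrt_pos.mpr hx
  have hsm := Real.sqrt_pos.mpr hm
  have h := Real.log_le_sub_one_of_pos (div_pos hsm hsx)
  rw [Real.log_div hsm.ne' hsx.ne', Real.log_sqrt hm.le, Real.log_sqrt hx.le] at h
  have h2 : x * (√m / √x) = √x * √m := by
    nth_rewrite 1 [← Real.mul_self_sqrt hx.le]
    field_simp
  have h3 := mul_le_mul_of_nonneg_left h hx.le
  rw [mul_sub x (√m / √x), h2] at h3
  linarith

/-- Uniform convexity of `klFun` in terms of the Hellinger distance. -/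
theorem half_sq_sqrt_sub_sqrt_le {x y : ℝ} (hx : 0 ≤ x) (hy : 0 ≤ y) :
    (√x - √y) ^ 2 / 2 ≤ klFun x + klFun y - 2 * klFun ((x + y) / 2) := by
  rcases (add_nonneg hx hy).eq_or_lt with h | h
  · have hx0 : x = 0 := by linarith
    have hy0 : y = 0 := by linarith
    subst hx0; subst hy0
    simp
    linarith [klFun_zero]
  set m := (x + y) / 2 with hm
  have hm0 : 0 < m := by positivity
  have h1 := mul_log_add_two_mul_sub_le hx hm0
  have h2 := mul_log_add_two_mul_sub_le hy hm0
  have sx := Real.mul_self_sqrt hx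
  have sy := Real.mul_self_sqrt hy
  have sm := Real.mul_self_sqrt hm0.le
  simp only [klFun_apply]
  have hxy : x + y = 2 * m := by rw [hm]; ring
  have h3 : x * Real.log m + y * Real.log m = 2 * m * Real.log m := by rw [← hxy]; ring
  nlinarith [sq_nonneg (√x + √y - 2 * √m)]

/-- Uniform convexity of `klFun` on `[0, ∞)` in a form that can be integrated: Cauchy-Schwarz with a
free parameter `l`. -/
theorem abs_sub_le_klFun {x y l : ℝ} (hx : 0 ≤ x) (hy : 0 ≤ y) (hl : 0 < l) :
    |x - y| ≤ l * (klFun x + klFun y - 2 * klFun ((x + y) / 2)) + (x + y) / l := by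
  have h := half_sq_sqrt_sub_sqrt_le hx hy
  have sx := Real.mul_self_sqrt hx
  have sy := Real.mul_self_sqrt hy
  have hfac : |x - y| = |√x - √y| * (√x + √y) := by
    have he : x - y = (√x - √y) * (√x + √y) := by linear_combination sy - sx
    rw [he, abs_mul, abs_of_nonneg (add_nonneg (Real.sqrt_nonneg x) (Real.sqrt_nonneg y))]
  have hsum : (√x + √y) ^ 2 / 2 ≤ x + y := by nlinarith [sq_nonneg (√x - √y)]
  calc |x - y| = |√x - √y| * (√x + √y) := hfac
    _ ≤ l * ((√x - √y) ^ 2 / 2) + (√x + √y) ^ 2 / 2 / l := by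
        rw [← sq_abs (√x - √y)]
        have : 0 ≤ (l * |√x - √y| - (√x + √y)) ^ 2 / (2 * l) := by positivity
        have e : (l * |√x - √y| - (√x + √y)) ^ 2 / (2 * l)
          = l * (|√x - √y| ^ 2 / 2) + (√x + √y) ^ 2 / 2 / l - |√x - √y| * (√x + √y) := by
            field_simp
            ring
        linarith
    _ ≤ _ := by gcongr

variable {α : Type*} [MeasurableSpace α] {μ : Measure α}

/-- Probability densities of finite relative entropy with respect to `μ`. -/
structure IsEntropyDensity (μ : Measure α) (g : α → ℝ) : Prop where
  measurable : Measurable g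
  nonneg : ∀ x, 0 ≤ g x
  integrable : Integrable g μ
  integral_eq_one : ∫ x, g x ∂μ = 1
  integrable_klFun : Integrable (fun x => klFun (g x)) μ

namespace IsEntropyDensity

variable {g h : α → ℝ}

theorem midpoint (hg : IsEntropyDensity μ g) (hh : IsEntropyDensity μ h) :
    IsEntropyDensity μ (fun x => (g x + h x) / 2) where
  measurable := (hg.measurable.add hh.measurable).div_const 2
  nonneg x := by have := hg.nonneg x; have := hh.nonneg x; positivity
  integrable := (hg.integrable.add hh.integrable).div_const 2
  integral_eq_one := by
    rw [integral_div, integral_add hg.integrable hh.integrable, hg.integral_eq_one,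
      hh.integral_eq_one]
    norm_num
  integrable_klFun := by
    refine Integrable.mono' ((hg.integrable_klFun.add hh.integrable_klFun).div_const 2)
      (measurable_klFun.comp
        ((hg.measurable.add hh.measurable).div_const 2)).aestronglyMeasurable
      (ae_of_all _ fun x => ?_)
    have h1 := hg.nonneg x
    have h2 := hh.nonneg x
    rw [Real.norm_of_nonneg (klFun_nonneg (by positivity))]
    have := half_sq_sqrt_sub_sqrt_le h1 h2
    have h3 : 0 ≤ (√(g x) - √(h x)) ^ 2 / 2 := by positivity
    simp only [Pi.add_apply]
    linarith

/-- The `L¹` distance of two densities is small if the entropy of their midpoint is not much below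
the mean of their entropies. -/
theorem integral_abs_sub_le (hg : IsEntropyDensity μ g) (hh : IsEntropyDensity μ h) {l : ℝ}
    (hl : 0 < l) :
    ∫ x, |g x - h x| ∂μ ≤ l * (∫ x, klFun (g x) ∂μ + ∫ x, klFun (h x) ∂μ
      - 2 * ∫ x, klFun ((g x + h x) / 2) ∂μ) + 2 / l := by
  have hI : Integrable (fun x => l * (klFun (g x) + klFun (h x) - 2 * klFun ((g x + h x) / 2)))
      μ := ((hg.integrable_klFun.add hh.integrable_klFun).sub
    ((hg.midpoint hh).integrable_klFun.const_mul 2)).const_mul l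
  have hI2 : Integrable (fun x => (g x + h x) / l) μ :=
    (hg.integrable.add hh.integrable).div_const l
  calc ∫ x, |g x - h x| ∂μ
      ≤ ∫ x, (l * (klFun (g x) + klFun (h x) - 2 * klFun ((g x + h x) / 2))
          + (g x + h x) / l) ∂μ :=
        integral_mono (hg.integrable.sub hh.integrable).abs (hI.add hI2)
          fun x => abs_sub_le_klFun (hg.nonneg x) (hh.nonneg x) hl
    _ = _ := by
        rw [integral_add hI hI2, integral_const_mul, integral_sub
          (hg.integrable_klFun.fun_add hh.integrable_klFun)
          ((hg.midpoint hh).integrable_klFun.const_mul 2), integral_const_mul,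
          integral_add hg.integrable_klFun hh.integrable_klFun, integral_div,
          integral_add hg.integrable hh.integrable, hg.integral_eq_one, hh.integral_eq_one]
        norm_num

theorem integral_klFun_nonneg (hg : IsEntropyDensity μ g) : 0 ≤ ∫ x, klFun (g x) ∂μ :=
  integral_nonneg fun x => klFun_nonneg (hg.nonneg x)

end IsEntropyDensity

variable {E : Type*} [NormedAddCommGroup E] [NormedSpace ℝ E]

theorem IsEntropyDensity.integrable_smul {g : α → ℝ} (hg : IsEntropyDensity μ g) {T : α → E}
    (hT : AEStronglyMeasurable T μ) {R : ℝ} (hR : ∀ᵐ x ∂μ, ‖T x‖ ≤ R) :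
    Integrable (fun x => g x • T x) μ :=
  hg.integrable.smul_bdd R hT hR

/-- An `L¹`-Cauchy sequence of densities has a limit density; relative entropy is lower
semicontinuous along it and means of bounded functions converge. -/
theorem exists_isEntropyDensity_of_cauchy {G : ℕ → α → ℝ} (hG : ∀ N, IsEntropyDensity μ (G N))
    {β : ℕ → ℝ} (hβ : Tendsto β atTop (𝓝 0))
    (hcau : ∀ N N', N ≤ N' → ∫ x, |G N x - G N' x| ∂μ ≤ β N)
    {c : ℝ} {γ : ℕ → ℝ} (hγ : Tendsto γ atTop (𝓝 c)) (hJ : ∀ N, ∫ x, klFun (G N x) ∂μ ≤ γ N)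
    {T : α → E} (hT : AEStronglyMeasurable T μ) {R : ℝ} (hR : ∀ᵐ x ∂μ, ‖T x‖ ≤ R) {m : E}
    (hm : Tendsto (fun N => ∫ x, G N x • T x ∂μ) atTop (𝓝 m)) :
    ∃ g, IsEntropyDensity μ g ∧ ∫ x, klFun (g x) ∂μ ≤ c ∧ ∫ x, g x • T x ∂μ = m := by
  let F : ℕ → Lp ℝ 1 μ := fun N => (hG N).integrable.toL1 (G N)
  have hcauF : CauchySeq F := by
    refine cauchySeq_of_le_tendsto_0' β (fun N N' hNN' => ?_) hβ
    refine le_trans (le_of_eq ?_) (hcau N N' hNN')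
    rw [L1.dist_eq_integral_dist]
    refine integral_congr_ae ?_
    filter_upwards [(hG N).integrable.coeFn_toL1, (hG N').integrable.coeFn_toL1] with x h1 h2
    simp only [F]
    rw [h1, h2, Real.dist_eq]
  obtain ⟨g₀, hg₀⟩ := cauchySeq_tendsto_of_complete hcauF
  have hg₀i : Integrable g₀ μ := L1.integrable_coeFn g₀
  have hL1 : Tendsto (fun N => ∫ x, ‖G N x - g₀ x‖ ∂μ) atTop (𝓝 0) := by
    have := tendsto_iff_dist_tendsto_zero.mp hg₀
    refine this.congr fun N => ?_
    rw [L1.dist_eq_integral_dist]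
    refine integral_congr_ae ?_
    filter_upwards [(hG N).integrable.coeFn_toL1] with x h1
    simp only [F]
    rw [h1, dist_eq_norm]
  obtain ⟨ns, hns, hae⟩ := (tendstoInMeasure_of_tendsto_Lp hg₀).exists_seq_tendsto_ae
  have hae' : ∀ᵐ x ∂μ, Tendsto (fun k => G (ns k) x) atTop (𝓝 (g₀ x)) := by
    have : ∀ᵐ x ∂μ, ∀ N, F N x = G N x := ae_all_iff.mpr fun N => (hG N).integrable.coeFn_toL1
    filter_upwards [hae, this] with x h1 h2
    simpa only [h2] using h1
  -- a nonnegative measurable version of the limit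
  let g : α → ℝ := fun x => max (g₀ x) 0
  have hgm : Measurable g := (Lp.stronglyMeasurable g₀).measurable.max measurable_const
  have hgg : g =ᵐ[μ] g₀ := by
    filter_upwards [hae'] with x hx
    exact max_eq_left (ge_of_tendsto' hx fun k => (hG _).nonneg x)
  have hgi : Integrable g μ := hg₀i.congr hgg.symm
  have hL1' : Tendsto (fun N => ∫ x, ‖G N x - g x‖ ∂μ) atTop (𝓝 0) := by
    refine hL1.congr fun N => integral_congr_ae ?_
    filter_upwards [hgg] with x hx
    rw [hx]
  have hg1 : ∫ x, g x ∂μ = 1 := by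
    have h : Tendsto (fun N => ∫ x, G N x ∂μ) atTop (𝓝 (∫ x, g x ∂μ)) := by
      rw [tendsto_iff_norm_sub_tendsto_zero]
      refine squeeze_zero (fun _ => norm_nonneg _) (fun N => ?_) hL1'
      rw [← integral_sub (hG N).integrable hgi]
      exact norm_integral_le_integral_norm _
    simp only [(hG _).integral_eq_one] at h
    exact tendsto_nhds_unique h tendsto_const_nhds
  have hgT : Integrable (fun x => g x • T x) μ := hgi.smul_bdd R hT hR
  have hmean : ∫ x, g x • T x ∂μ = m := by
    refine tendsto_nhds_unique ?_ hm
    rw [tendsto_iff_norm_sub_tendsto_zero]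
    refine squeeze_zero (fun _ => norm_nonneg _) (fun N => ?_)
      (by simpa using hL1'.mul_const R)
    rw [← integral_sub ((hG N).integrable_smul hT hR) hgT, ← integral_mul_const]
    refine norm_integral_le_of_norm_le (((hG N).integrable.sub hgi).norm.mul_const R) ?_
    filter_upwards [hR] with x hx
    rw [← sub_smul, norm_smul]
    gcongr
    rfl
  have hfatou : ∫⁻ x, ENNReal.ofReal (klFun (g x)) ∂μ ≤ ENNReal.ofReal c := by
    have h1 : ∫⁻ x, ENNReal.ofReal (klFun (g x)) ∂μ
        = ∫⁻ x, liminf (fun k => ENNReal.ofReal (klFun (G (ns k) x))) atTop ∂μ := by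
      refine lintegral_congr_ae ?_
      filter_upwards [hae', hgg] with x hx hx2
      refine (Tendsto.liminf_eq ?_).symm
      rw [hx2]
      exact ENNReal.tendsto_ofReal ((continuous_klFun.tendsto _).comp hx)
    rw [h1]
    refine (lintegral_liminf_le fun k => (measurable_klFun.comp
      (hG (ns k)).measurable).ennreal_ofReal).trans ?_
    have h2 : Tendsto (fun k => ENNReal.ofReal (γ (ns k))) atTop (𝓝 (ENNReal.ofReal c)) :=
      ENNReal.tendsto_ofReal (hγ.comp hns.tendsto_atTop)
    rw [← h2.liminf_eq]
    refine liminf_le_liminf (Eventually.of_forall fun k => ?_)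
    simp only [comp_apply]
    rw [← ofReal_integral_eq_lintegral_ofReal (hG _).integrable_klFun
      (ae_of_all _ fun x => klFun_nonneg ((hG _).nonneg x))]
    exact ENNReal.ofReal_le_ofReal (hJ _)
  have hnn : ∀ x, 0 ≤ g x := fun x => le_max_right _ _
  have hki : Integrable (fun x => klFun (g x)) μ := by
    rw [← lintegral_ofReal_ne_top_iff_integrable (f := fun x => klFun (g x))
      (measurable_klFun.comp hgm).aestronglyMeasurable
      (ae_of_all _ fun x => klFun_nonneg (hnn x))]
    exact (hfatou.trans_lt ENNReal.ofReal_lt_top).ne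
  refine ⟨g, ⟨hgm, hnn, hgi, hg1, hki⟩, ?_, hmean⟩
  have hc : 0 ≤ c := ge_of_tendsto' hγ fun N => ((hG N).integral_klFun_nonneg).trans (hJ N)
  rw [← ofReal_integral_eq_lintegral_ofReal hki (ae_of_all _ fun x => klFun_nonneg (hnn x))]
    at hfatou
  exact (ENNReal.ofReal_le_ofReal_iff hc).mp hfatou

/-- The set of pairs (mean of `T`, relative entropy), enlarged upwards in the entropy, is closed:
densities that nearly minimise the entropy among those with mean close to the limit form a Cauchy
sequence in `L¹`, by uniform convexity. -/
theorem exists_isEntropyDensity_of_tendsto {G : ℕ → α → ℝ} (hG : ∀ N, IsEntropyDensity μ (G N))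
    {c : ℝ} (hJ : Tendsto (fun N => ∫ x, klFun (G N x) ∂μ) atTop (𝓝 c))
    {T : α → E} (hT : AEStronglyMeasurable T μ) {R : ℝ} (hR : ∀ᵐ x ∂μ, ‖T x‖ ≤ R) {m : E}
    (hm : Tendsto (fun N => ∫ x, G N x • T x ∂μ) atTop (𝓝 m)) :
    ∃ g, IsEntropyDensity μ g ∧ ∫ x, klFun (g x) ∂μ ≤ c ∧ ∫ x, g x • T x ∂μ = m := by
  let δ : ℕ → ℝ := fun N => 1 / ((N : ℝ) + 1)
  have hδ : Tendsto δ atTop (𝓝 0) := tendsto_one_div_add_atTop_nhds_zero_nat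
  have hδpos : ∀ N, 0 < δ N := fun N => by positivity
  have hδanti : Antitone δ := fun N N' h => one_div_le_one_div_of_le (by positivity)
    (by have : (N : ℝ) ≤ N' := Nat.cast_le.mpr h
        linarith)
  -- `K N` is closed under midpoints, and `I N` is the infimum of the entropy on it
  let K : ℕ → Set (α → ℝ) := fun N =>
    {g | IsEntropyDensity μ g ∧ ‖∫ x, g x • T x ∂μ - m‖ ≤ δ N}
  let J : (α → ℝ) → ℝ := fun g => ∫ x, klFun (g x) ∂μ
  have hbdd : ∀ N, BddBelow (J '' K N) := fun N =>
    ⟨0, by rintro _ ⟨g, hg, rfl⟩; exact hg.1.integral_klFun_nonneg⟩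
  have hev : ∀ N, ∀ᶠ k in atTop, G k ∈ K N := fun N => by
    filter_upwards [(tendsto_iff_norm_sub_tendsto_zero.mp hm).eventually_le_const (hδpos N)]
      with k hk
    exact ⟨hG k, hk⟩
  have hne : ∀ N, (J '' K N).Nonempty := fun N => (hev N).exists.elim fun k hk => ⟨_, G k, hk, rfl⟩
  let I : ℕ → ℝ := fun N => sInf (J '' K N)
  have hIc : ∀ N, I N ≤ c := fun N => by
    refine ge_of_tendsto hJ ?_
    filter_upwards [hev N] with k hk
    exact csInf_le (hbdd N) ⟨_, hk, rfl⟩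
  have hImono : Monotone I := fun N N' h => by
    refine csInf_le_csInf (hbdd N) (hne N') (image_mono ?_)
    exact fun g hg => ⟨hg.1, hg.2.trans (hδanti h)⟩
  have hIlim : Tendsto I atTop (𝓝 (⨆ N, I N)) :=
    tendsto_atTop_ciSup hImono ⟨c, by rintro _ ⟨N, rfl⟩; exact hIc N⟩
  set s := ⨆ N, I N
  have hIs : ∀ N, I N ≤ s := hImono.ge_of_tendsto hIlim
  have hsc : s ≤ c := ciSup_le hIc
  have hex : ∀ N, ∃ g ∈ K N, J g < I N + δ N := fun N => by
    obtain ⟨_, ⟨g, hg, rfl⟩, h⟩ := Real.lt_sInf_add_pos (hne N) (hδpos N)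
    exact ⟨g, hg, h⟩
  choose H hHK hHJ using hex
  let β : ℕ → ℝ := fun N => s - I N + 2 * δ N
  have hβpos : ∀ N, 0 < β N := fun N => by
    have := hIs N; have := hδpos N
    simp only [β]; linarith
  have hβ : Tendsto β atTop (𝓝 0) := by
    simpa [β] using (hIlim.const_sub s).add (hδ.const_mul 2)
  refine exists_isEntropyDensity_of_cauchy (G := H) (fun N => (hHK N).1)
    (β := fun N => 3 * √(β N)) ?_ ?_ (γ := fun N => c + δ N) (by simpa using hδ.const_add c)
    (fun N => by have := hHJ N; have := hIc N; simp only [J] at *; linarith) hT hR ?_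
  · simpa using (hβ.sqrt).const_mul 3
  · -- the midpoint is admissible at level `N`, so its entropy is at least `I N`; the parameter
    -- `l = 1 / √(β N)` balances the two terms of `integral_abs_sub_le`
    intro N N' hNN'
    have hmid : (fun x => (H N x + H N' x) / 2) ∈ K N := by
      refine ⟨(hHK N).1.midpoint (hHK N').1, ?_⟩
      have h1 := (hHK N).2
      have h2 := (hHK N').2.trans (hδanti hNN')
      have he : ∫ x, ((H N x + H N' x) / 2) • T x ∂μ - m
          = (1 / 2 : ℝ) • (∫ x, H N x • T x ∂μ - m) + (1 / 2 : ℝ) • (∫ x, H N' x • T x ∂μ - m) := by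
        rw [← smul_add, sub_add_sub_comm, ← integral_add ((hHK N).1.integrable_smul hT hR)
          ((hHK N').1.integrable_smul hT hR), smul_sub, ← integral_smul]
        congr 1
        · refine integral_congr_ae (ae_of_all _ fun x => ?_)
          simp only [← add_smul, smul_smul]; congr 1; ring
        · rw [← two_smul ℝ m, smul_smul]; norm_num
      rw [he]
      refine (norm_add_le _ _).trans ?_
      rw [norm_smul, norm_smul]
      norm_num
      linarith
    have h1 := (hHK N).1.integral_abs_sub_le (hHK N').1
      (inv_pos.mpr (Real.sqrt_pos.mpr (hβpos N)))
    refine h1.trans ?_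
    have h2 : I N ≤ J fun x => (H N x + H N' x) / 2 := csInf_le (hbdd N) ⟨_, hmid, rfl⟩
    have h3 : J (H N) + J (H N') - 2 * J (fun x => (H N x + H N' x) / 2) ≤ β N := by
      have := hHJ N; have := hHJ N'; have := hIs N'; have := hδanti hNN'
      simp only [β]; linarith
    have hsq := Real.sqrt_pos.mpr (hβpos N)
    calc _ ≤ (√(β N))⁻¹ * β N + 2 / (√(β N))⁻¹ := by gcongr
      _ = 3 * √(β N) := by
          rw [inv_mul_eq_div, Real.div_sqrt, div_inv_eq_mul]; ring
  · rw [tendsto_iff_norm_sub_tendsto_zero]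
    exact squeeze_zero (fun _ => norm_nonneg _) (fun N => (hHK N).2) hδ

end EntropyClosure

/-! ### Relative entropy and tilts -/

section RelativeEntropy

variable {α : Type*} [MeasurableSpace α] {μ ν : Measure α} [IsProbabilityMeasure μ]
  [IsProbabilityMeasure ν]

theorem isEntropyDensity_rnDeriv (h : klDiv ν μ ≠ ⊤) :
    IsEntropyDensity μ (fun x => (ν.rnDeriv μ x).toReal) ∧
      ∫ x, klFun (ν.rnDeriv μ x).toReal ∂μ = (klDiv ν μ).toReal := by
  obtain ⟨hac, hint⟩ := klDiv_ne_top_iff.mp h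
  refine ⟨⟨(Measure.measurable_rnDeriv ν μ).ennreal_toReal, fun _ => ENNReal.toReal_nonneg,
    Measure.integrable_toReal_rnDeriv, ?_, (integrable_klFun_rnDeriv_iff hac).mpr hint⟩,
    (toReal_klDiv_eq_integral_klFun hac).symm⟩
  rw [Measure.integral_toReal_rnDeriv hac, probReal_univ]

theorem IsEntropyDensity.withDensity {g : α → ℝ} (hg : IsEntropyDensity μ g)
    {E : Type*} [NormedAddCommGroup E] [NormedSpace ℝ E] (T : α → E) :
    ∃ ν : Measure α, IsProbabilityMeasure ν ∧ ν ≪ μ ∧ klDiv ν μ ≠ ⊤ ∧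
      (klDiv ν μ).toReal = ∫ x, klFun (g x) ∂μ ∧ ∫ x, T x ∂ν = ∫ x, g x • T x ∂μ := by
  have hprob : IsProbabilityMeasure (μ.withDensity fun x => ENNReal.ofReal (g x)) := by
    refine ⟨?_⟩
    rw [withDensity_apply _ MeasurableSet.univ, Measure.restrict_univ,
      ← ofReal_integral_eq_lintegral_ofReal hg.integrable (ae_of_all _ hg.nonneg),
      hg.integral_eq_one, ENNReal.ofReal_one]
  have hac := withDensity_absolutelyContinuous μ fun x => ENNReal.ofReal (g x)
  have hrn : (fun x => ((μ.withDensity fun x => ENNReal.ofReal (g x)).rnDeriv μ x).toReal)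
      =ᵐ[μ] g := by
    filter_upwards [Measure.rnDeriv_withDensity μ hg.measurable.ennreal_ofReal] with x hx
    rw [hx, ENNReal.toReal_ofReal (hg.nonneg x)]
  refine ⟨_, hprob, hac, klDiv_ne_top hac ?_, ?_, ?_⟩
  · rw [← integrable_klFun_rnDeriv_iff hac]
    refine hg.integrable_klFun.congr ?_
    filter_upwards [hrn] with x hx
    rw [hx]
  · rw [toReal_klDiv_eq_integral_klFun hac]
    refine integral_congr_ae ?_
    filter_upwards [hrn] with x hx
    rw [hx]
  · rw [← integral_rnDeriv_smul hac]
    refine integral_congr_ae ?_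
    filter_upwards [hrn] with x hx
    rw [hx]

/-- Closedness of the pairs (mean of `T`, upper bound of the relative entropy), for measures. -/
theorem exists_measure_of_tendsto_klDiv {ν : ℕ → Measure α} [∀ k, IsProbabilityMeasure (ν k)]
    (hν : ∀ k, klDiv (ν k) μ ≠ ⊤) {c : ℝ}
    (hc : Tendsto (fun k => (klDiv (ν k) μ).toReal) atTop (𝓝 c))
    {E : Type*} [NormedAddCommGroup E] [NormedSpace ℝ E] {T : α → E}
    (hT : AEStronglyMeasurable T μ) {R : ℝ} (hR : ∀ᵐ x ∂μ, ‖T x‖ ≤ R) {m : E}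
    (hm : Tendsto (fun k => ∫ x, T x ∂(ν k)) atTop (𝓝 m)) :
    ∃ ν' : Measure α, IsProbabilityMeasure ν' ∧ ν' ≪ μ ∧ klDiv ν' μ ≠ ⊤ ∧
      (klDiv ν' μ).toReal ≤ c ∧ ∫ x, T x ∂ν' = m := by
  obtain ⟨g, hg, hJ, hgm⟩ := exists_isEntropyDensity_of_tendsto
    (fun k => (isEntropyDensity_rnDeriv (hν k)).1)
    (by simpa only [(isEntropyDensity_rnDeriv (hν _)).2] using hc) hT hR (m := m)
    (by simpa only [integral_rnDeriv_smul (klDiv_ne_top_iff.mp (hν _)).1] using hm)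
  obtain ⟨ν', h1, h2, h3, h4, h5⟩ := hg.withDensity T
  exact ⟨ν', h1, h2, h3, h4.trans_le hJ, h5.trans hgm⟩

theorem toReal_klDiv_tilted {g : α → ℝ} (hg : AEMeasurable g μ) {C : ℝ}
    (hC : ∀ᵐ x ∂μ, |g x| ≤ C) :
    klDiv (μ.tilted g) μ ≠ ⊤ ∧ (klDiv (μ.tilted g) μ).toReal
      = ∫ x, g x ∂(μ.tilted g) - Real.log (∫ x, Real.exp (g x) ∂μ) := by
  have hi := integrable_exp_of_ae_abs_le hg hC
  have := isProbabilityMeasure_tilted hi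
  have hac := tilted_absolutelyContinuous μ g
  have hllr : llr (μ.tilted g) μ =ᵐ[μ.tilted g]
      fun x => g x - Real.log (∫ z, Real.exp (g z) ∂μ) :=
    hac.ae_le (log_rnDeriv_tilted_left_self hi)
  have hgi : Integrable g (μ.tilted g) :=
    integrable_tilted_of_bound hg.aestronglyMeasurable (s := {x | |g x| ≤ C}) hC fun _ h => h
  have hint : Integrable (llr (μ.tilted g) μ) (μ.tilted g) :=
    (hgi.sub (integrable_const _)).congr hllr.symm
  refine ⟨klDiv_ne_top hac hint, ?_⟩
  rw [toReal_klDiv_of_measure_eq hac (by simp), integral_congr_ae hllr,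
    integral_sub hgi (integrable_const _)]
  simp

/-- The Gibbs variational inequality. -/
theorem integral_sub_toReal_klDiv_le_log_integral_exp (hν : klDiv ν μ ≠ ⊤) {g : α → ℝ}
    (hg : AEMeasurable g μ) {C : ℝ} (hC : ∀ᵐ x ∂μ, |g x| ≤ C) :
    ∫ x, g x ∂ν - (klDiv ν μ).toReal ≤ Real.log (∫ x, Real.exp (g x) ∂μ) := by
  obtain ⟨hac, hint⟩ := klDiv_ne_top_iff.mp hν
  have hi := integrable_exp_of_ae_abs_le hg hC
  have := isProbabilityMeasure_tilted hi
  have hgν : Integrable g ν :=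
    Integrable.of_bound (hg.aestronglyMeasurable.mono_ac hac) C (hac.ae_le hC)
  have h1 := integral_llr_tilted_right hac hgν hi hint
  have h2 := toReal_klDiv_of_measure_eq (hac.trans (absolutelyContinuous_tilted hi))
    (by simp : ν univ = (μ.tilted g) univ)
  have h3 := toReal_klDiv_of_measure_eq hac (by simp : ν univ = μ univ)
  have h4 : 0 ≤ (klDiv ν (μ.tilted g)).toReal := ENNReal.toReal_nonneg
  linarith

end RelativeEntropy

theorem mean_mem {E : Type*} [NormedAddCommGroup E] [NormedSpace ℝ E] [CompleteSpace E]
    [MeasurableSpace E] [BorelSpace E] {ν : Measure E} [IsProbabilityMeasure ν] {K : Set E}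
    (hK : IsCompact K) (hconv : Convex ℝ K) (hν : ∀ᵐ z ∂ν, z ∈ K) : mean ν ∈ K := by
  have h1 : ν K = 1 := by rwa [← mem_ae_iff_prob_eq_one hK.measurableSet]
  exact hconv.integral_mem hK.isClosed hν (integrable_id_of_isCompact hK h1)

/-! ### The variational problem has a maximiser -/

theorem coe_sub_coe_sum_klDiv {ι : Type*} [Fintype ι] {X : ι → Type*}
    [∀ i, MeasurableSpace (X i)] {μ ν : ∀ i, Measure (X i)} (hν : ∀ i, klDiv (ν i) (μ i) ≠ ⊤)
    (r : ℝ) :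
    (r : EReal) - ((∑ i, klDiv (ν i) (μ i) : ENNReal) : EReal)
      = ((r - ∑ i, (klDiv (ν i) (μ i)).toReal : ℝ) : EReal) := by
  rw [← ENNReal.toReal_sum fun i _ => hν i, EReal.coe_sub,
    EReal.coe_ennreal_toReal (ENNReal.sum_ne_top.mpr fun i _ => hν i)]

section Maximum

variable {n : ℕ} {V : Fin n → Type*} [∀ i, NormedAddCommGroup (V i)] [∀ i, NormedSpace ℝ (V i)]
  [∀ i, MeasurableSpace (V i)] {μ : ∀ i, Measure (V i)} [∀ i, IsProbabilityMeasure (μ i)]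
  {f : (∀ i, V i) → ℝ}

theorem coe_mem_meanFieldValues {ν : ∀ i, Measure (V i)} [∀ i, IsProbabilityMeasure (ν i)]
    (hν : ∀ i, klDiv (ν i) (μ i) ≠ ⊤) :
    ((f (fun i => mean (ν i)) - ∑ i, (klDiv (ν i) (μ i)).toReal : ℝ) : EReal)
      ∈ meanFieldValues μ f :=
  ⟨ν, inferInstance, pi_absolutelyContinuous_pi μ fun i => (klDiv_ne_top_iff.mp (hν i)).1,
    (coe_sub_coe_sum_klDiv hν _).symm⟩

omit [∀ i, IsProbabilityMeasure (μ i)] in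
theorem exists_of_mem_meanFieldValues {w : EReal} (hw : w ∈ meanFieldValues μ f) :
    w = ⊥ ∨ ∃ ν : ∀ i, Measure (V i), (∀ i, IsProbabilityMeasure (ν i)) ∧
      (∀ i, klDiv (ν i) (μ i) ≠ ⊤) ∧
      w = ((f (fun i => mean (ν i)) - ∑ i, (klDiv (ν i) (μ i)).toReal : ℝ) : EReal) := by
  obtain ⟨ν, hν, -, rfl⟩ := hw
  by_cases h : ∀ i, klDiv (ν i) (μ i) ≠ ⊤
  · exact Or.inr ⟨ν, hν, h, coe_sub_coe_sum_klDiv h _⟩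
  · left
    push Not at h
    rw [ENNReal.sum_eq_top.mpr (by simpa using h), EReal.coe_ennreal_top, EReal.sub_top]

/-- Continuity of `f` on the compact set of means, together with closedness in each coordinate, lets
a maximising sequence pass to a limit with at least the limiting value. -/
theorem exists_isGreatest_meanFieldValues [∀ i, CompleteSpace (V i)] [∀ i, BorelSpace (V i)]
    {W : ∀ i, Set (V i)} (hWcompact : ∀ i, IsCompact (W i)) (hWconvex : ∀ i, Convex ℝ (W i))
    (hμW : ∀ i, ∀ᵐ z ∂(μ i), z ∈ W i) (hf : Continuous f) :
    ∃ v : ℝ, IsGreatest (meanFieldValues μ f) (v : EReal) := by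
  let S : Set ℝ := {r | ∃ ν : ∀ i, Measure (V i), (∀ i, IsProbabilityMeasure (ν i)) ∧
      (∀ i, klDiv (ν i) (μ i) ≠ ⊤) ∧
      r = f (fun i => mean (ν i)) - ∑ i, (klDiv (ν i) (μ i)).toReal}
  obtain ⟨a, ha⟩ := (isCompact_univ_pi hWcompact).exists_bound_of_continuousOn hf.continuousOn
  have hmem : ∀ ν : ∀ i, Measure (V i), (∀ i, IsProbabilityMeasure (ν i)) →
      (∀ i, klDiv (ν i) (μ i) ≠ ⊤) → (fun i => mean (ν i)) ∈ univ.pi W := fun ν hν hk i _ =>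
    mean_mem (hWcompact i) (hWconvex i) ((klDiv_ne_top_iff.mp (hk i)).1.ae_le (hμW i))
  have hSne : S.Nonempty := ⟨_, μ, inferInstance, fun i => by simp, rfl⟩
  have hSb : BddAbove S := by
    refine ⟨a, ?_⟩
    rintro _ ⟨ν, hν, hk, rfl⟩
    have h1 := (abs_le.mp (ha _ (hmem ν hν hk))).2
    have h2 : 0 ≤ ∑ i, (klDiv (ν i) (μ i)).toReal :=
      Finset.sum_nonneg fun i _ => ENNReal.toReal_nonneg
    linarith
  obtain ⟨u, -, hu, huS⟩ := exists_seq_tendsto_sSup hSne hSb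
  choose ν hν hk hur using huS
  have hbdd : BddBelow (range u) := hu.bddBelow_range
  obtain ⟨r₀, hr₀⟩ := hbdd
  -- means and entropies stay in a compact set
  have hcomp : ∀ k, ((fun i => mean (ν k i)), fun i => (klDiv (ν k i) (μ i)).toReal)
      ∈ (univ.pi W) ×ˢ (univ.pi fun _ : Fin n => Icc (0 : ℝ) (a - r₀)) := by
    refine fun k => ⟨hmem _ (hν k) (hk k), fun i _ => ⟨ENNReal.toReal_nonneg, ?_⟩⟩
    have h1 := (abs_le.mp (ha _ (hmem _ (hν k) (hk k)))).2
    have h2 := hr₀ ⟨k, rfl⟩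
    have h3 := Finset.single_le_sum (f := fun i => (klDiv (ν k i) (μ i)).toReal)
      (fun i _ => ENNReal.toReal_nonneg) (Finset.mem_univ i)
    have h4 := hur k
    simp only at h3 ⊢
    linarith
  obtain ⟨⟨m, c⟩, -, φ, hφ, hlim⟩ := ((isCompact_univ_pi hWcompact).prod
    (isCompact_univ_pi fun _ : Fin n => isCompact_Icc)).tendsto_subseq hcomp
  rw [nhds_prod_eq, tendsto_prod_iff'] at hlim
  obtain ⟨hm, hc⟩ := hlim
  rw [tendsto_pi_nhds] at hc
  have hm' := tendsto_pi_nhds.mp hm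
  have hlimit : ∀ i, ∃ ν' : Measure (V i), IsProbabilityMeasure ν' ∧ ν' ≪ μ i ∧
      klDiv ν' (μ i) ≠ ⊤ ∧ (klDiv ν' (μ i)).toReal ≤ c i ∧ ∫ z, z ∂ν' = m i := fun i => by
    obtain ⟨R, hR⟩ := (hWcompact i).isBounded.exists_norm_le
    have := fun k => hν (φ k) i
    have hprob : μ i (W i) = 1 := by
      rw [← mem_ae_iff_prob_eq_one (hWcompact i).measurableSet]; exact hμW i
    exact exists_measure_of_tendsto_klDiv (fun k => hk (φ k) i) (hc i)
      (integrable_id_of_isCompact (hWcompact i) hprob).1 ((hμW i).mono fun z hz => hR z hz)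
      (hm' i)
  choose ν' h1 h2 h3 h4 h5 using hlimit
  have hmean : (fun i => mean (ν' i)) = m := funext h5
  have hv : sSup S = f m - ∑ i, c i := by
    refine tendsto_nhds_unique (hu.comp hφ.tendsto_atTop) ?_
    have : u ∘ φ = fun k => f (fun i => mean (ν (φ k) i))
        - ∑ i, (klDiv (ν (φ k) i) (μ i)).toReal := funext fun k => hur (φ k)
    rw [this]
    exact ((hf.tendsto m).comp hm).sub (tendsto_finsetSum _ fun i _ => hc i)
  have hle : sSup S ≤ f (fun i => mean (ν' i)) - ∑ i, (klDiv (ν' i) (μ i)).toReal := by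
    rw [hv, hmean]
    gcongr with i
    exact h4 i
  refine ⟨_, coe_mem_meanFieldValues h3, ?_⟩
  intro w hw
  rcases exists_of_mem_meanFieldValues hw with rfl | ⟨ρ, hρ, hρk, rfl⟩
  · exact bot_le
  · exact EReal.coe_le_coe_iff.mpr ((le_csSup hSb ⟨ρ, hρ, hρk, rfl⟩).trans hle)

end Maximum

/-! ### Common assumptions of both bounds -/

section Setting

variable {n : ℕ} {V : Fin n → Type*} [∀ i, NormedAddCommGroup (V i)] [∀ i, NormedSpace ℝ (V i)]
  [∀ i, MeasurableSpace (V i)]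

/-- The assumptions on `μ`, `W` and `f` used in both bounds. -/
structure BoundedSetting (μ : ∀ i, Measure (V i)) (W : ∀ i, Set (V i)) (f : (∀ i, V i) → ℝ)
    (a : ℝ) (b : Fin n → ℝ) (c : Fin n → Fin n → ℝ) (M : ℝ) : Prop where
  isCompact : ∀ i, IsCompact (W i)
  convex : ∀ i, Convex ℝ (W i)
  ae_mem : ∀ i, ∀ᵐ z ∂(μ i), z ∈ W i
  differentiable : TwiceFrechetDifferentiable f
  b_nonneg : ∀ i, 0 ≤ b i
  c_pos : ∀ i j, 0 < c i j
  abs_apply_le : ∀ x ∈ univ.pi W, |f x| ≤ a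
  norm_partialDeriv_le : ∀ x ∈ univ.pi W, ∀ i, ‖partialDeriv f i x‖ ≤ b i
  abs_partialDeriv₂_le : ∀ x ∈ univ.pi W, ∀ i j, ∀ (z : V i) (r : V j), max ‖r‖ ‖z‖ ≤ 1 →
      |partialDeriv₂ f i j x z r| ≤ c i j
  M_nonneg : 0 ≤ M
  norm_sub_le_of_mem : ∀ i, ∀ z₁ ∈ W i, ∀ z₂ ∈ W i, ‖z₁ - z₂‖ ≤ M

end Setting

/-! ### The lower bound -/

section LowerBound

variable {n : ℕ} {V : Fin n → Type*} [∀ i, NormedAddCommGroup (V i)] [∀ i, NormedSpace ℝ (V i)]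
  [∀ i, CompleteSpace (V i)] [∀ i, MeasurableSpace (V i)] [∀ i, BorelSpace (V i)]
  {μ : ∀ i, Measure (V i)} [∀ i, IsProbabilityMeasure (μ i)]
  {W : ∀ i, Set (V i)} {f : (∀ i, V i) → ℝ} {a M : ℝ} {b : Fin n → ℝ} {c : Fin n → Fin n → ℝ}

theorem integral_apply_sub_mean {E : Type*} [NormedAddCommGroup E] [NormedSpace ℝ E]
    [CompleteSpace E] [MeasurableSpace E] {ν : Measure E} [IsProbabilityMeasure ν]
    (hν : Integrable (fun z : E => z) ν) (L : E →L[ℝ] ℝ) :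
    Integrable (fun z => L (z - mean ν)) ν ∧ ∫ z, L (z - mean ν) ∂ν = 0 := by
  have h1 : Integrable (fun z => z - mean ν) ν := hν.sub (integrable_const _)
  refine ⟨L.integrable_comp h1, ?_⟩
  rw [L.integral_comp_comm h1, integral_sub hν (integrable_const _)]
  simp [mean]

/-- One coordinate of the lower bound: the linear part of `f` averages out around the mean, which
leaves the Gibbs variational inequality and a second order remainder. -/
theorem BoundedSetting.sub_toReal_klDiv_le_log_integral_update (h : BoundedSetting μ W f a b c M)
    {i : Fin n} {ν : Measure (V i)} [IsProbabilityMeasure ν] (hν : klDiv ν (μ i) ≠ ⊤)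
    {y : ∀ i, V i} (hy : y ∈ univ.pi W) (hyi : y i = mean ν) :
    f y - ((klDiv ν (μ i)).toReal + M ^ 2 / 2 * c i i)
      ≤ Real.log (∫ z, Real.exp (f (update y i z)) ∂(μ i)) := by
  have hνW : ∀ᵐ z ∂ν, z ∈ W i := (klDiv_ne_top_iff.mp hν).1.ae_le (h.ae_mem i)
  have hν1 : ν (W i) = 1 := by rwa [← mem_ae_iff_prob_eq_one (h.isCompact i).measurableSet]
  have hid := integrable_id_of_isCompact (h.isCompact i) hν1
  have hcont : Continuous fun z : V i => f (update y i z) :=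
    h.differentiable.1.continuous.comp (continuous_const.update i continuous_id)
  have hbd : ∀ z ∈ W i, |f (update y i z)| ≤ a := fun z hz =>
    h.abs_apply_le _ (update_mem_univ_pi hy hz)
  have hgibbs := integral_sub_toReal_klDiv_le_log_integral_exp hν hcont.measurable.aemeasurable
    ((h.ae_mem i).mono hbd)
  have hint : Integrable (fun z => f (update y i z)) ν :=
    Integrable.of_bound hcont.measurable.aestronglyMeasurable a (hνW.mono hbd)
  have hm : mean ν ∈ W i := hyi ▸ hy i (mem_univ i)
  have hyu : update y i (mean ν) = y := by rw [← hyi, update_eq_self]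
  obtain ⟨hLi, hL⟩ := integral_apply_sub_mean hid (partialDeriv f i y)
  have h1 : ∫ z, (f y - M ^ 2 / 2 * c i i + partialDeriv f i y (z - mean ν)) ∂ν
      ≤ ∫ z, f (update y i z) ∂ν := by
    refine integral_mono_ae ((integrable_const _).add hLi) hint ?_
    filter_upwards [hνW] with z hz
    have hT := (abs_le.mp (abs_update_sub_update_sub_le h.differentiable h.convex h.c_pos
      h.abs_partialDeriv₂_le hy hz hm)).1
    rw [hyu] at hT
    have hsq : ‖z - mean ν‖ ^ 2 ≤ M ^ 2 := by
      gcongr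
      exact h.norm_sub_le_of_mem i z hz _ hm
    have := mul_le_mul_of_nonneg_left hsq (half_pos (h.c_pos i i)).le
    linarith
  rw [integral_add (integrable_const _) hLi, hL] at h1
  simp only [integral_const, probReal_univ, smul_eq_mul, one_mul] at h1
  linarith

/-- The lower bound: the coordinates in `s` are distributed according to `μ`, the others are frozen
at the means of `ν`, and `s` grows by one coordinate at a time. -/
theorem BoundedSetting.sub_sum_klDiv_le_log_integral_exp (h : BoundedSetting μ W f a b c M)
    {ν : ∀ i, Measure (V i)} [∀ i, IsProbabilityMeasure (ν i)]
    (hν : ∀ i, klDiv (ν i) (μ i) ≠ ⊤) :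
    f (fun i => mean (ν i)) - ∑ i, (klDiv (ν i) (μ i)).toReal - M ^ 2 / 2 * ∑ i, c i i
      ≤ Real.log (∫ x, Real.exp (f x) ∂(Measure.pi μ)) := by
  set m : ∀ i, V i := fun i => mean (ν i) with hm
  have hmW : m ∈ univ.pi W := fun i _ =>
    mean_mem (h.isCompact i) (h.convex i) ((klDiv_ne_top_iff.mp (hν i)).1.ae_le (h.ae_mem i))
  have hcont : ∀ s : Finset (Fin n), Continuous fun x : ∀ i, V i => s.piecewise x m := by
    refine fun s => continuous_pi fun j => ?_
    by_cases hj : j ∈ s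
    · simpa [hj] using continuous_apply j
    · simpa [hj] using continuous_const
  have hint : ∀ s : Finset (Fin n),
      Integrable (fun x => Real.exp (f (s.piecewise x m))) (Measure.pi μ) := fun s =>
    integrable_pi_of_continuousOn μ h.isCompact h.ae_mem
      (Real.continuous_exp.comp (h.differentiable.1.continuous.comp (hcont s))).continuousOn
  have hind : ∀ s : Finset (Fin n),
      Real.exp (f m - ∑ i ∈ s, ((klDiv (ν i) (μ i)).toReal + M ^ 2 / 2 * c i i))
        ≤ ∫ x, Real.exp (f (s.piecewise x m)) ∂(Measure.pi μ) := by
    intro s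
    induction s using Finset.induction_on with
    | empty => simp
    | insert i s his ih =>
      rw [integral_pi_eq_integral_integral_update μ (hint _) i, Finset.sum_insert his]
      set e := (klDiv (ν i) (μ i)).toReal + M ^ 2 / 2 * c i i
      calc Real.exp (f m - (e + ∑ i ∈ s, ((klDiv (ν i) (μ i)).toReal + M ^ 2 / 2 * c i i)))
          = Real.exp (-e) * Real.exp (f m - ∑ i ∈ s,
              ((klDiv (ν i) (μ i)).toReal + M ^ 2 / 2 * c i i)) := by
            rw [← Real.exp_add]; congr 1; ring
        _ ≤ Real.exp (-e) * ∫ x, Real.exp (f (s.piecewise x m)) ∂(Measure.pi μ) := by gcongr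
        _ = ∫ x, Real.exp (-e) * Real.exp (f (s.piecewise x m)) ∂(Measure.pi μ) :=
            (integral_const_mul _ _).symm
        _ ≤ _ := by
            refine integral_mono_ae ((hint s).const_mul _)
              (integrable_integral_update μ (hint _) i) ?_
            filter_upwards [ae_mem_univ_pi μ h.ae_mem] with x hx
            have hy : s.piecewise x m ∈ univ.pi W := by
              intro j hj
              by_cases hjs : j ∈ s
              · simpa [hjs] using hx j hj
              · simpa [hjs] using hmW j hj
            have hupd : ∀ z : V i, (insert i s).piecewise (update x i z) m
                = update (s.piecewise x m) i z := by
              intro z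
              ext j
              rcases eq_or_ne j i with rfl | hj
              · simp
              · by_cases hjs : j ∈ s <;> simp [hj, hjs]
            simp only [hupd]
            have hlog := h.sub_toReal_klDiv_le_log_integral_update (hν i) hy (by simp [his, hm])
            have hi : Integrable (fun z => Real.exp (f (update (s.piecewise x m) i z))) (μ i) :=
              integrable_exp_of_ae_abs_le (h.differentiable.1.continuous.comp
                (continuous_const.update i continuous_id)).measurable.aemeasurable
                ((h.ae_mem i).mono fun z hz => h.abs_apply_le _ (update_mem_univ_pi hy hz))
            rw [Real.le_log_iff_exp_le (integral_exp_pos hi)] at hlog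
            refine le_trans (le_of_eq ?_) hlog
            rw [← Real.exp_add]; congr 1; ring
  have hfull := hind Finset.univ
  simp only [Finset.piecewise_univ] at hfull
  have hpos : 0 < ∫ x, Real.exp (f x) ∂(Measure.pi μ) := (Real.exp_pos _).trans_le hfull
  rw [Real.le_log_iff_exp_le hpos]
  refine le_trans (le_of_eq ?_) hfull
  rw [Finset.sum_add_distrib, Finset.mul_sum]
  congr 1; ring

end LowerBound

/-! ### Conditional means under the Gibbs measure -/

section UpperBound

theorem norm_mean_tilted_sub_le {E : Type*} [NormedAddCommGroup E] [NormedSpace ℝ E]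
    [CompleteSpace E] [MeasurableSpace E] [BorelSpace E] {μ : Measure E} [IsProbabilityMeasure μ]
    {K : Set E} (hK : IsCompact K) (hμK : ∀ᵐ z ∂μ, z ∈ K) {g₀ g₁ : E → ℝ} (hg₀ : Continuous g₀)
    (hg₁ : Continuous g₁) {M s : ℝ} (hM : ∀ z ∈ K, ∀ z' ∈ K, ‖z - z'‖ ≤ M)
    (hs : ∀ z ∈ K, ∀ z' ∈ K, |g₁ z - g₀ z - (g₁ z' - g₀ z')| ≤ s) :
    ‖mean (μ.tilted g₁) - mean (μ.tilted g₀)‖ ≤ M * s := by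
  obtain ⟨C₀, hC₀⟩ := hK.exists_bound_of_continuousOn hg₀.continuousOn
  obtain ⟨C₁, hC₁⟩ := hK.exists_bound_of_continuousOn hg₁.continuousOn
  have hprob : μ K = 1 := by rwa [← mem_ae_iff_prob_eq_one hK.measurableSet]
  exact norm_integral_tilted_sub_le (integrable_id_of_isCompact hK hprob).1
    hg₀.measurable.aemeasurable hg₁.measurable.aemeasurable hμK (C := max C₀ C₁)
    (fun z hz => (hC₀ z hz).trans (le_max_left _ _))
    (fun z hz => (hC₁ z hz).trans (le_max_right _ _)) hM hs

theorem isProbabilityMeasure_tilted_of_continuous {E : Type*} [TopologicalSpace E]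
    [MeasurableSpace E] [BorelSpace E] {μ : Measure E} [IsProbabilityMeasure μ]
    {K : Set E} (hK : IsCompact K) (hμK : ∀ᵐ z ∂μ, z ∈ K) {g : E → ℝ} (hg : Continuous g) :
    IsProbabilityMeasure (μ.tilted g) := by
  obtain ⟨C, hC⟩ := hK.exists_bound_of_continuousOn hg.continuousOn
  exact isProbabilityMeasure_tilted
    (integrable_exp_of_ae_abs_le hg.measurable.aemeasurable (hμK.mono hC))

variable {n : ℕ} {V : Fin n → Type*} [∀ i, NormedAddCommGroup (V i)] [∀ i, NormedSpace ℝ (V i)]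
  [∀ i, MeasurableSpace (V i)]

/-- The conditional mean of the `i`-th coordinate under the Gibbs measure `e^f dμ`, given the other
coordinates of `x`. -/
def condMean (μ : ∀ i, Measure (V i)) (f : (∀ i, V i) → ℝ) (x : ∀ i, V i) (i : Fin n) : V i :=
  mean ((μ i).tilted fun z => f (update x i z))

/-- The point that has the conditional means in the first `k` coordinates and agrees with `x` in
the others. -/
def partialCondMean (μ : ∀ i, Measure (V i)) (f : (∀ i, V i) → ℝ) (k : ℕ) (x : ∀ i, V i) :
    ∀ i, V i :=
  fun j => if (j : ℕ) < k then condMean μ f x j else x j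

theorem condMean_update_self (μ : ∀ i, Measure (V i)) (f : (∀ i, V i) → ℝ) (x : ∀ i, V i)
    (i : Fin n) (w : V i) : condMean μ f (update x i w) i = condMean μ f x i := by
  simp [condMean]

theorem update_partialCondMean (μ : ∀ i, Measure (V i)) (f : (∀ i, V i) → ℝ) (x : ∀ i, V i)
    (i : Fin n) : update (partialCondMean μ f i x) i (condMean μ f x i)
      = partialCondMean μ f (i + 1) x := by
  ext j
  rcases eq_or_ne j i with rfl | hj
  · simp [partialCondMean]
  · have : (j : ℕ) ≠ i := fun h => hj (Fin.ext h)
    have : (j : ℕ) < i + 1 ↔ (j : ℕ) < i := by omega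
    simp [partialCondMean, hj, this]

theorem sum_sub_partialCondMean (μ : ∀ i, Measure (V i)) (f : (∀ i, V i) → ℝ) (x : ∀ i, V i) :
    ∑ i : Fin n, (f (partialCondMean μ f i x) - f (partialCondMean μ f (i + 1) x))
      = f x - f (condMean μ f x) := by
  rw [Fin.sum_univ_eq_sum_range
    (fun k => f (partialCondMean μ f k x) - f (partialCondMean μ f (k + 1) x)) n,
    Finset.sum_range_sub' fun k => f (partialCondMean μ f k x)]
  have h0 : partialCondMean μ f 0 x = x := by ext j; simp [partialCondMean]
  have hn : partialCondMean μ f n x = condMean μ f x := by ext j; simp [partialCondMean]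
  rw [h0, hn]

namespace BoundedSetting

variable [∀ i, BorelSpace (V i)] {μ : ∀ i, Measure (V i)}
  {W : ∀ i, Set (V i)} {f : (∀ i, V i) → ℝ} {a M : ℝ} {b : Fin n → ℝ} {c : Fin n → Fin n → ℝ}

omit [∀ i, BorelSpace (V i)] in
theorem continuous_update (h : BoundedSetting μ W f a b c M) (x : ∀ i, V i) (i : Fin n) :
    Continuous fun z : V i => f (update x i z) :=
  h.differentiable.1.continuous.comp (continuous_const.update i continuous_id)

variable [∀ i, IsProbabilityMeasure (μ i)]

theorem isProbabilityMeasure_cond (h : BoundedSetting μ W f a b c M) (x : ∀ i, V i) (i : Fin n) :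
    IsProbabilityMeasure ((μ i).tilted fun z => f (update x i z)) :=
  isProbabilityMeasure_tilted_of_continuous (h.isCompact i) (h.ae_mem i) (h.continuous_update x i)

variable [∀ i, CompleteSpace (V i)]

theorem condMean_mem (h : BoundedSetting μ W f a b c M) (x : ∀ i, V i) :
    condMean μ f x ∈ univ.pi W := fun i _ => by
  have := h.isProbabilityMeasure_cond x i
  exact mean_mem (h.isCompact i) (h.convex i)
    ((tilted_absolutelyContinuous (μ i) _).ae_le (h.ae_mem i))

theorem partialCondMean_mem (h : BoundedSetting μ W f a b c M) (k : ℕ) {x : ∀ i, V i}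
    (hx : x ∈ univ.pi W) : partialCondMean μ f k x ∈ univ.pi W := fun i hi => by
  unfold partialCondMean
  split_ifs
  · exact h.condMean_mem x i hi
  · exact hx i hi

theorem norm_condMean_sub_condMean_le (h : BoundedSetting μ W f a b c M) {x y : ∀ i, V i}
    {i : Fin n} {s : ℝ} (hs : ∀ z ∈ W i, ∀ z' ∈ W i,
      |f (update x i z) - f (update y i z) - (f (update x i z') - f (update y i z'))| ≤ s) :
    ‖condMean μ f x i - condMean μ f y i‖ ≤ M * s :=
  norm_mean_tilted_sub_le (h.isCompact i) (h.ae_mem i) (h.continuous_update y i)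
    (h.continuous_update x i) (h.norm_sub_le_of_mem i) hs

/-- Changing the `i`-th coordinate moves the conditional mean of the `j`-th one by at most
`M³ c i j`, because the conditional log-density changes by a mixed second difference of `f`. -/
theorem norm_condMean_update_sub_le (h : BoundedSetting μ W f a b c M) {x : ∀ i, V i}
    (hx : x ∈ univ.pi W) {i j : Fin n} (hij : j ≠ i) {w : V i} (hw : w ∈ W i) :
    ‖condMean μ f (update x i w) j - condMean μ f x j‖ ≤ M ^ 3 * c i j := by
  refine (h.norm_condMean_sub_condMean_le (s := c i j * M * M) fun z hz z' hz' => ?_).trans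
    (le_of_eq (by ring))
  have h1 := abs_update_sub_update_sub_update_sub_update_le h.differentiable h.convex h.c_pos
    h.abs_partialDeriv₂_le (update_mem_univ_pi hx hz) (update_mem_univ_pi hx hz') hw
    (hx i (mem_univ i))
  have hself : ∀ z : V j, update (update x j z) i (x i) = update x j z := fun z => by
    rw [update_eq_self_iff, update_of_ne hij.symm]
  rw [hself, hself, update_comm hij, update_comm hij] at h1
  refine h1.trans ?_
  have hsum : ∑ l ∈ Finset.univ.erase i, c i l * ‖update x j z l - update x j z' l‖
      = c i j * ‖z - z'‖ := by
    rw [Finset.sum_eq_single j]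
    · simp
    · intro l _ hl; simp [hl]
    · intro hj; simp [hij] at hj
  rw [hsum]
  have := (h.c_pos i j).le
  have := h.M_nonneg
  gcongr
  · exact h.norm_sub_le_of_mem j z hz z' hz'
  · exact h.norm_sub_le_of_mem i w hw _ (hx i (mem_univ i))

theorem continuousOn_condMean (h : BoundedSetting μ W f a b c M) (i : Fin n) :
    ContinuousOn (fun x => condMean μ f x i) (univ.pi W) := by
  intro x hx
  rw [ContinuousWithinAt, tendsto_iff_norm_sub_tendsto_zero]
  have hlim : Tendsto (fun y : ∀ i, V i => M * (2 * ∑ j, b j * ‖y j - x j‖)) (𝓝[univ.pi W] x)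
      (𝓝 0) := by
    have hc : Continuous fun y : ∀ i, V i => M * (2 * ∑ j, b j * ‖y j - x j‖) := by fun_prop
    simpa using (hc.tendsto x).mono_left nhdsWithin_le_nhds
  refine squeeze_zero' (Eventually.of_forall fun _ => norm_nonneg _) ?_ hlim
  filter_upwards [self_mem_nhdsWithin] with y hy
  refine h.norm_condMean_sub_condMean_le fun z hz z' hz' => ?_
  have hb : ∀ z ∈ W i, |f (update y i z) - f (update x i z)| ≤ ∑ j, b j * ‖y j - x j‖ := by
    intro z hz
    refine (abs_sub_le_sum_of_partialDeriv_le h.differentiable h.convex h.norm_partialDeriv_le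
      (update_mem_univ_pi hy hz) (update_mem_univ_pi hx hz)).trans ?_
    refine Finset.sum_le_sum fun j _ => mul_le_mul_of_nonneg_left ?_ (h.b_nonneg j)
    rcases eq_or_ne j i with rfl | hj
    · simp
    · simp [hj]
  have h1 := hb z hz
  have h2 := hb z' hz'
  rw [abs_le] at h1 h2 ⊢
  constructor <;> linarith [h1.1, h1.2, h2.1, h2.2]

theorem continuousOn_partialCondMean (h : BoundedSetting μ W f a b c M) (k : ℕ) :
    ContinuousOn (partialCondMean μ f k) (univ.pi W) := by
  refine continuousOn_pi.mpr fun j => ?_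
  unfold partialCondMean
  split_ifs
  · exact h.continuousOn_condMean j
  · exact (continuous_apply j).continuousOn

omit [∀ i, BorelSpace (V i)] [∀ i, IsProbabilityMeasure (μ i)] [∀ i, CompleteSpace (V i)] in
theorem continuousOn_partialDeriv (h : BoundedSetting μ W f a b c M) (i : Fin n) :
    ContinuousOn (fun x => partialDeriv f i x) (univ.pi W) := by
  intro x hx
  rw [ContinuousWithinAt, tendsto_iff_norm_sub_tendsto_zero]
  have hlim : Tendsto (fun y : ∀ i, V i => ∑ j, c i j * ‖y j - x j‖) (𝓝[univ.pi W] x) (𝓝 0) := by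
    have hc : Continuous fun y : ∀ i, V i => ∑ j, c i j * ‖y j - x j‖ := by fun_prop
    simpa using (hc.tendsto x).mono_left nhdsWithin_le_nhds
  refine squeeze_zero' (Eventually.of_forall fun _ => norm_nonneg _) ?_ hlim
  filter_upwards [self_mem_nhdsWithin] with y hy
  exact norm_partialDeriv_sub_le h.differentiable h.convex h.c_pos h.abs_partialDeriv₂_le hy hx i

omit [∀ i, BorelSpace (V i)] [∀ i, IsProbabilityMeasure (μ i)] [∀ i, CompleteSpace (V i)] in
theorem norm_partialDeriv_update_sub_le (h : BoundedSetting μ W f a b c M) {x : ∀ i, V i}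
    (hx : x ∈ univ.pi W) {i : Fin n} {w : V i} (hw : w ∈ W i) :
    ‖partialDeriv f i (update x i w) - partialDeriv f i x‖ ≤ c i i * M := by
  refine (norm_partialDeriv_sub_le h.differentiable h.convex h.c_pos h.abs_partialDeriv₂_le
    (update_mem_univ_pi hx hw) hx i).trans ?_
  rw [Finset.sum_eq_single i (fun j _ hj => by simp [hj]) (by simp), update_self]
  exact mul_le_mul_of_nonneg_left (h.norm_sub_le_of_mem i w hw _ (hx i (mem_univ i)))
    (h.c_pos i i).le

omit [∀ i, CompleteSpace (V i)] in
/-- A bound on all conditional expectations given the coordinates other than the `i`-th one bounds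
the expectation under the (unnormalised) Gibbs measure. -/
theorem integral_mul_exp_le (h : BoundedSetting μ W f a b c M) (i : Fin n)
    {ψ : (∀ i, V i) → ℝ} (hψ : ContinuousOn ψ (univ.pi W)) {C : ℝ}
    (hC : ∀ x ∈ univ.pi W, ∫ z, ψ (update x i z) ∂((μ i).tilted fun z => f (update x i z)) ≤ C) :
    ∫ x, ψ x * Real.exp (f x) ∂(Measure.pi μ) ≤ C * ∫ x, Real.exp (f x) ∂(Measure.pi μ) := by
  have hexp : ContinuousOn (fun x => Real.exp (f x)) (univ.pi W) :=
    (Real.continuous_exp.comp h.differentiable.1.continuous).continuousOn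
  have hi1 := integrable_pi_of_continuousOn μ h.isCompact h.ae_mem (hψ.fun_mul hexp)
  have hi2 := integrable_pi_of_continuousOn μ h.isCompact h.ae_mem hexp
  rw [integral_pi_eq_integral_integral_update μ hi1 i,
    integral_pi_eq_integral_integral_update μ hi2 i, ← integral_const_mul]
  refine integral_mono_ae (integrable_integral_update μ hi1 i)
    ((integrable_integral_update μ hi2 i).const_mul C) ?_
  filter_upwards [ae_mem_univ_pi μ h.ae_mem] with x hx
  have hint : Integrable (fun z => Real.exp (f (update x i z))) (μ i) :=
    integrable_exp_of_ae_abs_le (h.continuous_update x i).measurable.aemeasurable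
      ((h.ae_mem i).mono fun z hz => h.abs_apply_le _ (update_mem_univ_pi hx hz))
  have hpos := integral_exp_pos hint
  have h1 := hC x hx
  rw [integral_tilted] at h1
  have h2 : ∫ z, (Real.exp (f (update x i z)) / ∫ z, Real.exp (f (update x i z)) ∂(μ i))
      • ψ (update x i z) ∂(μ i) = (∫ z, ψ (update x i z) * Real.exp (f (update x i z)) ∂(μ i))
        / ∫ z, Real.exp (f (update x i z)) ∂(μ i) := by
    rw [← integral_div]
    refine integral_congr_ae (ae_of_all _ fun z => ?_)
    simp only [smul_eq_mul]; ring
  rw [h2, div_le_iff₀ hpos] at h1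
  exact h1

omit [∀ i, CompleteSpace (V i)] in
theorem integrable_id_cond (h : BoundedSetting μ W f a b c M) (x : ∀ i, V i) (i : Fin n) :
    Integrable (fun z : V i => z) ((μ i).tilted fun z => f (update x i z)) := by
  have := h.isProbabilityMeasure_cond x i
  refine integrable_id_of_isCompact (h.isCompact i) ?_
  rw [← mem_ae_iff_prob_eq_one (h.isCompact i).measurableSet]
  exact (tilted_absolutelyContinuous (μ i) _).ae_le (h.ae_mem i)

/-- If `ψ` is bounded by an affine function of the `i`-th coordinate whose linear part is centred
at the conditional mean, then only the constant contributes to the expectation. -/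
theorem integral_mul_exp_le_of_affine (h : BoundedSetting μ W f a b c M) (i : Fin n)
    {ψ : (∀ i, V i) → ℝ} (hψ : ContinuousOn ψ (univ.pi W)) {C : ℝ}
    (L : (∀ i, V i) → V i →L[ℝ] ℝ)
    (hC : ∀ x ∈ univ.pi W, ∀ z ∈ W i,
      ψ (update x i z) ≤ C + L x (z - condMean μ f x i)) :
    ∫ x, ψ x * Real.exp (f x) ∂(Measure.pi μ) ≤ C * ∫ x, Real.exp (f x) ∂(Measure.pi μ) := by
  refine h.integral_mul_exp_le i hψ fun x hx => ?_
  have := h.isProbabilityMeasure_cond x i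
  have hW : ∀ᵐ z ∂((μ i).tilted fun z => f (update x i z)), z ∈ W i :=
    (tilted_absolutelyContinuous (μ i) _).ae_le (h.ae_mem i)
  obtain ⟨hLi, hL⟩ := integral_apply_sub_mean (h.integrable_id_cond x i) (L x)
  rw [← condMean] at hLi hL
  have hψx : ContinuousOn (fun z => ψ (update x i z)) (W i) :=
    hψ.comp (continuous_const.update i continuous_id).continuousOn
      fun z hz => update_mem_univ_pi hx hz
  have hint : Integrable (fun z => ψ (update x i z)) ((μ i).tilted fun z => f (update x i z)) := by
    have := hψx.integrableOn_compact (μ := (μ i).tilted fun z => f (update x i z)) (h.isCompact i)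
    rwa [IntegrableOn, Measure.restrict_eq_self_of_ae_mem hW] at this
  calc _ ≤ ∫ z, (C + L x (z - condMean μ f x i)) ∂((μ i).tilted fun z => f (update x i z)) := by
        refine integral_mono_ae hint ((integrable_const _).add hLi) ?_
        filter_upwards [hW] with z hz using hC x hx z hz
    _ = C := by
        rw [integral_add (integrable_const _) hLi, hL]
        simp

/-- The Gibbs expectation of the `i`-th telescoping increment. Resampling the `i`-th coordinate
changes the earlier coordinates of `partialCondMean` only through the mixed second differences,
which gives the fourth order term; the Taylor remainder in the `i`-th coordinate gives the second
order term. -/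
theorem integral_telescope_mul_exp_le (h : BoundedSetting μ W f a b c M) (i : Fin n) :
    ∫ x, (f (partialCondMean μ f i x) - f (partialCondMean μ f (i + 1) x)) * Real.exp (f x)
        ∂(Measure.pi μ)
      ≤ (M ^ 2 * c i i + M ^ 4 * ∑ j, c i j ^ 2) * ∫ x, Real.exp (f x) ∂(Measure.pi μ) := by
  have hfc := h.differentiable.1.continuous
  refine h.integral_mul_exp_le_of_affine i
    (ψ := fun x => f (partialCondMean μ f i x) - f (partialCondMean μ f (i + 1) x))
    ((hfc.comp_continuousOn (h.continuousOn_partialCondMean i)).sub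
      (hfc.comp_continuousOn (h.continuousOn_partialCondMean (i + 1))))
    (fun x => partialDeriv f i (update (partialCondMean μ f i x) i (condMean μ f x i)))
    fun x hx z hz => ?_
  have hM := h.M_nonneg
  have hx' := update_mem_univ_pi hx hz
  have hmi := h.condMean_mem x i (mem_univ i)
  set y := partialCondMean μ f i x with hy
  set y' := partialCondMean μ f i (update x i z) with hy'
  have hyW : y ∈ univ.pi W := h.partialCondMean_mem i hx
  have hyW' : y' ∈ univ.pi W := h.partialCondMean_mem i hx'
  have e1 : partialCondMean μ f (i + 1) (update x i z) = update y' i (condMean μ f x i) := by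
    rw [← update_partialCondMean, condMean_update_self]
  have e2 : y' = update y' i z := by
    rw [eq_comm, update_eq_self_iff, hy']; simp [partialCondMean]
  rw [e1]
  nth_rewrite 1 [e2]
  have h1 := (abs_le.mp (abs_update_sub_update_sub_update_sub_update_le h.differentiable h.convex
    h.c_pos h.abs_partialDeriv₂_le hyW' hyW hz hmi)).2
  have h2 := (abs_le.mp (abs_update_sub_update_sub_le h.differentiable h.convex h.c_pos
    h.abs_partialDeriv₂_le hyW hz hmi)).2
  have hz' : ‖z - condMean μ f x i‖ ≤ M := h.norm_sub_le_of_mem i z hz _ hmi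
  have h3 : (∑ j ∈ Finset.univ.erase i, c i j * ‖y' j - y j‖) * ‖z - condMean μ f x i‖
      ≤ M ^ 4 * ∑ j, c i j ^ 2 := by
    have h4 : ∑ j ∈ Finset.univ.erase i, c i j * ‖y' j - y j‖ ≤ M ^ 3 * ∑ j, c i j ^ 2 := by
      rw [Finset.mul_sum]
      refine (Finset.sum_le_sum fun j hj => ?_).trans
        (Finset.sum_le_sum_of_subset_of_nonneg (Finset.erase_subset i Finset.univ)
          fun j _ _ => by positivity)
      have hji := Finset.ne_of_mem_erase hj
      have hcp := h.c_pos i j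
      have : ‖y' j - y j‖ ≤ M ^ 3 * c i j := by
        simp only [hy, hy', partialCondMean]
        split_ifs
        · exact h.norm_condMean_update_sub_le hx hji hz
        · rw [update_of_ne hji, sub_self, norm_zero]; positivity
      calc c i j * ‖y' j - y j‖ ≤ c i j * (M ^ 3 * c i j) := by gcongr
        _ = M ^ 3 * c i j ^ 2 := by ring
    calc _ ≤ (M ^ 3 * ∑ j, c i j ^ 2) * M := by gcongr
      _ = _ := by ring
  have h5 : c i i / 2 * ‖z - condMean μ f x i‖ ^ 2 ≤ M ^ 2 * c i i := by
    have hcp := h.c_pos i i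
    have : ‖z - condMean μ f x i‖ ^ 2 ≤ M ^ 2 := by gcongr
    nlinarith [mul_le_mul_of_nonneg_left this hcp.le, sq_nonneg ‖z - condMean μ f x i‖]
  linarith

/-- With the slope evaluated at a point independent of the `i`-th coordinate the left-hand side
would vanish; moving that coordinate changes the slope by at most `c i i * M`. -/
theorem integral_partialDeriv_mul_exp_le (h : BoundedSetting μ W f a b c M) (i : Fin n) :
    ∫ x, -(partialDeriv f i x (x i - condMean μ f x i)) * Real.exp (f x) ∂(Measure.pi μ)
      ≤ M ^ 2 * c i i * ∫ x, Real.exp (f x) ∂(Measure.pi μ) := by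
  refine h.integral_mul_exp_le_of_affine i
    (ψ := fun x => -(partialDeriv f i x (x i - condMean μ f x i)))
    (((h.continuousOn_partialDeriv i).clm_apply
      ((continuous_apply i).continuousOn.sub (h.continuousOn_condMean i))).neg)
    (fun x => -partialDeriv f i x) fun x hx z hz => ?_
  have hM := h.M_nonneg
  rw [condMean_update_self, update_self]
  have hz' : ‖z - condMean μ f x i‖ ≤ M :=
    h.norm_sub_le_of_mem i z hz _ (h.condMean_mem x i (mem_univ i))
  have h1 := (abs_le.mp ((partialDeriv f i (update x i z) - partialDeriv f i x).le_of_opNorm_le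
    (h.norm_partialDeriv_update_sub_le hx hz) (z - condMean μ f x i))).1
  have h2 : c i i * M * ‖z - condMean μ f x i‖ ≤ M ^ 2 * c i i := by
    have hcp := h.c_pos i i
    calc _ ≤ c i i * M * M := by gcongr
      _ = _ := by ring
  simp only [sub_apply, neg_apply] at h1 ⊢
  linarith

end BoundedSetting

end UpperBound

/-! ### The error terms -/

section ErrorTerms

variable {n : ℕ} {a M ε : ℝ} {b : Fin n → ℝ} {c : Fin n → Fin n → ℝ}

/-- The geometric mean of the two bounds is dominated by `errorB₁`. -/
theorem le_errorB₁ (hb : ∀ i, 0 ≤ b i) (hc : ∀ i j, 0 ≤ c i j) (hM : 0 ≤ M) {r : ℝ}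
    (h1 : r ≤ 2 * a) (h2 : r ≤ M ^ 2 * ∑ i, c i i + M ^ 4 * ∑ i, ∑ j, c i j ^ 2) :
    r ≤ errorB₁ M a b c := by
  unfold errorB₁
  set S := M ^ 2 * (a * ∑ i, c i i + ∑ i, b i ^ 2)
      + M ^ 3 * ∑ i, ∑ j, b i * c i j
      + M ^ 4 * (a * ∑ i, ∑ j, c i j ^ 2 + ∑ i, ∑ j, b i * b j * c i j) with hS
  set Q := M ^ 2 * ∑ i, c i i + M ^ 4 * ∑ i, ∑ j, c i j ^ 2 with hQ
  have hQS : a * Q ≤ S := by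
    have e1 : 0 ≤ M ^ 2 * ∑ i, b i ^ 2 := by positivity
    have e2 : 0 ≤ M ^ 3 * ∑ i, ∑ j, b i * c i j := mul_nonneg (by positivity)
      (Finset.sum_nonneg fun i _ => Finset.sum_nonneg fun j _ => mul_nonneg (hb i) (hc i j))
    have e3 : 0 ≤ M ^ 4 * ∑ i, ∑ j, b i * b j * c i j := mul_nonneg (by positivity)
      (Finset.sum_nonneg fun i _ => Finset.sum_nonneg fun j _ =>
        mul_nonneg (mul_nonneg (hb i) (hb j)) (hc i j))
    rw [hS, hQ]
    linarith
  rcases le_or_gt r 0 with hr | hr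
  · exact hr.trans (by positivity)
  have hr2 : r ^ 2 ≤ 16 * S := by nlinarith [mul_le_mul h1 h2 hr.le (by linarith)]
  calc r = √(r ^ 2) := (Real.sqrt_sq hr.le).symm
    _ ≤ √(16 * S) := Real.sqrt_le_sqrt hr2
    _ = 4 * √S := by
        rw [Real.sqrt_mul (by norm_num), show (16 : ℝ) = 4 ^ 2 by norm_num,
          Real.sqrt_sq (by norm_num)]

/-- Here `δ i` stands for the distance of the `i`-th partial differential to its approximation in
the finite set. -/
theorem sum_le_errorB₂ (hM : 0 ≤ M) (hε : 0 ≤ ε) {δ : Fin n → ℝ}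
    (hδε : ∑ i, δ i ^ 2 ≤ ε ^ 2 * n) :
    ∑ i, (2 * b i + δ i) * (M ^ 3 * c i i + M ^ 2 * δ i) + M * ∑ i, δ i + ∑ i, M ^ 2 * c i i
      ≤ errorB₂ M ε b c := by
  unfold errorB₂
  have hδ2 : √(∑ i, δ i ^ 2) ≤ √n * ε := by
    calc √(∑ i, δ i ^ 2) ≤ √(ε ^ 2 * n) := Real.sqrt_le_sqrt hδε
      _ = √n * ε := by rw [Real.sqrt_mul (sq_nonneg ε), Real.sqrt_sq hε, mul_comm]
  have h1 : √(∑ i, (2 * b i + δ i) ^ 2) ≤ 4 * √(∑ i, b i ^ 2 + ε ^ 2 * n) := by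
    have e : 4 * √(∑ i, b i ^ 2 + ε ^ 2 * n) = √(4 ^ 2 * (∑ i, b i ^ 2 + ε ^ 2 * n)) := by
      rw [Real.sqrt_mul (by norm_num), Real.sqrt_sq (by norm_num)]
    rw [e]
    refine Real.sqrt_le_sqrt ?_
    calc ∑ i, (2 * b i + δ i) ^ 2 ≤ ∑ i, (4 ^ 2 * b i ^ 2 + 4 ^ 2 * δ i ^ 2) :=
          Finset.sum_le_sum fun i _ => by
            nlinarith [sq_nonneg (2 * b i - δ i), sq_nonneg (b i), sq_nonneg (δ i)]
      _ = 4 ^ 2 * (∑ i, b i ^ 2 + ∑ i, δ i ^ 2) := by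
          rw [Finset.sum_add_distrib, ← Finset.mul_sum, ← Finset.mul_sum, mul_add]
      _ ≤ _ := by gcongr
  have h2 : ∑ i, (2 * b i + δ i) * c i i ≤ 4 * √(∑ i, b i ^ 2 + ε ^ 2 * n)
      * √(∑ i, c i i ^ 2) :=
    (Real.sum_mul_le_sqrt_mul_sqrt _ _ _).trans (by gcongr)
  have h3 : ∑ i, (2 * b i + δ i) * δ i ≤ 4 * √(∑ i, b i ^ 2 + ε ^ 2 * n) * (√n * ε) :=
    (Real.sum_mul_le_sqrt_mul_sqrt _ _ _).trans (by gcongr)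
  have h4 : ∑ i, δ i ≤ n * ε := by
    have h := Real.sum_mul_le_sqrt_mul_sqrt Finset.univ (fun _ : Fin n => (1 : ℝ)) δ
    simp only [one_mul, one_pow, Finset.sum_const, Finset.card_univ, Fintype.card_fin,
      nsmul_eq_mul, mul_one] at h
    calc ∑ i, δ i ≤ √n * √(∑ i, δ i ^ 2) := h
      _ ≤ √n * (√n * ε) := by gcongr
      _ = n * ε := by rw [← mul_assoc, Real.mul_self_sqrt (Nat.cast_nonneg n)]
  have h5 : ∑ i, (2 * b i + δ i) * (M ^ 3 * c i i + M ^ 2 * δ i)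
      = M ^ 3 * ∑ i, (2 * b i + δ i) * c i i + M ^ 2 * ∑ i, (2 * b i + δ i) * δ i := by
    rw [Finset.mul_sum, Finset.mul_sum, ← Finset.sum_add_distrib]
    exact Finset.sum_congr rfl fun i _ => by ring
  have h6 := mul_le_mul_of_nonneg_left h2 (by positivity : 0 ≤ M ^ 3)
  have h7 := mul_le_mul_of_nonneg_left h3 (by positivity : 0 ≤ M ^ 2)
  have h8 := mul_le_mul_of_nonneg_left h4 hM
  rw [h5]
  linarith

end ErrorTerms

/-! ### The upper bound -/

/-- The deviation of `f` at `x` from its first order expansion, with slope `f'(x)`, around the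
point of conditional means. -/
def linearizationError {n : ℕ} {V : Fin n → Type*} [∀ i, NormedAddCommGroup (V i)]
    [∀ i, NormedSpace ℝ (V i)] [∀ i, MeasurableSpace (V i)] (μ : ∀ i, Measure (V i))
    (f : (∀ i, V i) → ℝ) (x : ∀ i, V i) : ℝ :=
  f x - f (condMean μ f x) - ∑ i, partialDeriv f i x (x i - condMean μ f x i)

namespace BoundedSetting

variable {n : ℕ} {V : Fin n → Type*} [∀ i, NormedAddCommGroup (V i)] [∀ i, NormedSpace ℝ (V i)]
  [∀ i, MeasurableSpace (V i)] [∀ i, BorelSpace (V i)] [∀ i, CompleteSpace (V i)]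
  {μ : ∀ i, Measure (V i)} [∀ i, IsProbabilityMeasure (μ i)]
  {W : ∀ i, Set (V i)} {f : (∀ i, V i) → ℝ} {a M : ℝ} {b : Fin n → ℝ} {c : Fin n → Fin n → ℝ}

omit [∀ i, CompleteSpace (V i)] in
theorem integrable_exp (h : BoundedSetting μ W f a b c M) :
    Integrable (fun x => Real.exp (f x)) (Measure.pi μ) :=
  integrable_pi_of_continuousOn μ h.isCompact h.ae_mem
    (Real.continuous_exp.comp h.differentiable.1.continuous).continuousOn

theorem continuousOn_linearizationError (h : BoundedSetting μ W f a b c M) :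
    ContinuousOn (linearizationError μ f) (univ.pi W) := by
  have hfc := h.differentiable.1.continuous
  refine (hfc.continuousOn.sub (hfc.comp_continuousOn
    (continuousOn_pi.mpr h.continuousOn_condMean))).sub
    (continuousOn_finsetSum _ fun i _ => (h.continuousOn_partialDeriv i).clm_apply
      ((continuous_apply i).continuousOn.sub (h.continuousOn_condMean i)))

/-- The Gibbs expectation of `f x - f (condMean x)` is at most the minimum of the trivial bound
`2 a` and of the sum of the telescoping bounds, and so at most `errorB₁`. -/
theorem integral_sub_condMean_mul_exp_le (h : BoundedSetting μ W f a b c M) :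
    ∫ x, (f x - f (condMean μ f x)) * Real.exp (f x) ∂(Measure.pi μ)
      ≤ errorB₁ M a b c * ∫ x, Real.exp (f x) ∂(Measure.pi μ) := by
  have hfc := h.differentiable.1.continuous
  have hexp : ContinuousOn (fun x => Real.exp (f x)) (univ.pi W) :=
    (Real.continuous_exp.comp hfc).continuousOn
  have hpos : 0 < ∫ x, Real.exp (f x) ∂(Measure.pi μ) := integral_exp_pos h.integrable_exp
  have hint : Integrable (fun x => (f x - f (condMean μ f x)) * Real.exp (f x)) (Measure.pi μ) :=
    integrable_pi_of_continuousOn μ h.isCompact h.ae_mem ((hfc.continuousOn.sub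
      (hfc.comp_continuousOn (continuousOn_pi.mpr h.continuousOn_condMean))).fun_mul hexp)
  have hinti : ∀ i : Fin n, Integrable (fun x => (f (partialCondMean μ f i x)
      - f (partialCondMean μ f (i + 1) x)) * Real.exp (f x)) (Measure.pi μ) := fun i =>
    integrable_pi_of_continuousOn μ h.isCompact h.ae_mem
      (((hfc.comp_continuousOn (h.continuousOn_partialCondMean i)).sub
        (hfc.comp_continuousOn (h.continuousOn_partialCondMean (i + 1)))).fun_mul hexp)
  have h1 : ∫ x, (f x - f (condMean μ f x)) * Real.exp (f x) ∂(Measure.pi μ)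
      ≤ 2 * a * ∫ x, Real.exp (f x) ∂(Measure.pi μ) := by
    rw [← integral_const_mul]
    refine integral_mono_ae hint (h.integrable_exp.const_mul _) ?_
    filter_upwards [ae_mem_univ_pi μ h.ae_mem] with x hx
    have e1 := (_root_.abs_le.mp (h.abs_apply_le x hx)).2
    have e2 := (_root_.abs_le.mp (h.abs_apply_le _ (h.condMean_mem x))).1
    gcongr
    linarith
  have h2 : ∫ x, (f x - f (condMean μ f x)) * Real.exp (f x) ∂(Measure.pi μ)
      ≤ (M ^ 2 * ∑ i, c i i + M ^ 4 * ∑ i, ∑ j, c i j ^ 2)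
        * ∫ x, Real.exp (f x) ∂(Measure.pi μ) := by
    simp_rw [← sum_sub_partialCondMean, Finset.sum_mul]
    rw [integral_finsetSum _ fun i _ => hinti i, Finset.mul_sum, Finset.mul_sum,
      ← Finset.sum_add_distrib, Finset.sum_mul]
    exact Finset.sum_le_sum fun i _ => h.integral_telescope_mul_exp_le i
  rw [← div_le_iff₀ hpos] at h1 h2 ⊢
  exact le_errorB₁ h.b_nonneg (fun i j => (h.c_pos i j).le) h.M_nonneg h1 h2

theorem integral_linearizationError_mul_exp_le (h : BoundedSetting μ W f a b c M) :
    ∫ x, linearizationError μ f x * Real.exp (f x) ∂(Measure.pi μ)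
      ≤ (errorB₁ M a b c + ∑ i, M ^ 2 * c i i) * ∫ x, Real.exp (f x) ∂(Measure.pi μ) := by
  have hfc := h.differentiable.1.continuous
  have hexp : ContinuousOn (fun x => Real.exp (f x)) (univ.pi W) :=
    (Real.continuous_exp.comp hfc).continuousOn
  have hint : Integrable (fun x => (f x - f (condMean μ f x)) * Real.exp (f x)) (Measure.pi μ) :=
    integrable_pi_of_continuousOn μ h.isCompact h.ae_mem ((hfc.continuousOn.sub
      (hfc.comp_continuousOn (continuousOn_pi.mpr h.continuousOn_condMean))).fun_mul hexp)
  have hinti : ∀ i : Fin n, Integrable (fun x => -(partialDeriv f i x (x i - condMean μ f x i))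
      * Real.exp (f x)) (Measure.pi μ) := fun i =>
    integrable_pi_of_continuousOn μ h.isCompact h.ae_mem
      (((h.continuousOn_partialDeriv i).clm_apply ((continuous_apply i).continuousOn.sub
        (h.continuousOn_condMean i))).fun_neg.fun_mul hexp)
  have hsplit : ∀ x, linearizationError μ f x * Real.exp (f x)
      = (f x - f (condMean μ f x)) * Real.exp (f x)
        + ∑ i, -(partialDeriv f i x (x i - condMean μ f x i)) * Real.exp (f x) := fun x => by
    rw [linearizationError, ← Finset.sum_mul, Finset.sum_neg_distrib]; ring
  simp_rw [hsplit]
  rw [integral_add hint (integrable_finsetSum _ fun i _ => hinti i),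
    integral_finsetSum _ fun i _ => hinti i, add_mul, Finset.sum_mul]
  exact add_le_add (h.integral_sub_condMean_mul_exp_le)
    (Finset.sum_le_sum fun i _ => h.integral_partialDeriv_mul_exp_le i)

/-- Pointwise comparison of the first order expansion of `f` with the log-density of the product of
the tilts of the `μ i` by functionals `d i` close to the partial differentials at `x`. -/
theorem sub_linearizationError_le (h : BoundedSetting μ W f a b c M) {ε : ℝ} (hε : 0 ≤ ε)
    {x : ∀ i, V i} (hx : x ∈ univ.pi W) {d : ∀ i, V i →L[ℝ] ℝ}
    (hd : ∑ i, ‖partialDeriv f i x - d i‖ ^ 2 ≤ ε ^ 2 * n) :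
    f x - linearizationError μ f x + ∑ i, M ^ 2 * c i i
      ≤ f (fun i => mean ((μ i).tilted (d i)))
        + ∑ i, d i (x i - mean ((μ i).tilted (d i))) + errorB₂ M ε b c := by
  have hM := h.M_nonneg
  have hmem := h.condMean_mem x
  set y := condMean μ f x with hy
  set p : ∀ i, V i := fun i => mean ((μ i).tilted (d i)) with hp
  set δ : Fin n → ℝ := fun i => ‖partialDeriv f i x - d i‖ with hδ
  have hpW : p ∈ univ.pi W := fun i _ => by
    have := isProbabilityMeasure_tilted_of_continuous (h.isCompact i) (h.ae_mem i) (d i).continuous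
    exact mean_mem (h.isCompact i) (h.convex i)
      ((tilted_absolutelyContinuous (μ i) _).ae_le (h.ae_mem i))
  have hyp : ∀ i, ‖y i - p i‖ ≤ M ^ 3 * c i i + M ^ 2 * δ i := fun i => by
    refine (norm_mean_tilted_sub_le (h.isCompact i) (h.ae_mem i) (d i).continuous
      (h.continuous_update x i) (h.norm_sub_le_of_mem i) (s := c i i * M * M + δ i * M)
      fun z hz z' hz' => ?_).trans (le_of_eq (by ring))
    have hzM := h.norm_sub_le_of_mem i z hz z' hz'
    have e1 := abs_update_sub_update_sub_apply_le h.differentiable h.convex hz hz'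
      (partialDeriv f i x) fun w hw => h.norm_partialDeriv_update_sub_le hx hw
    have e2 := (partialDeriv f i x - d i).le_opNorm (z - z')
    have e3 : f (update x i z) - d i z - (f (update x i z') - d i z')
        = (f (update x i z) - f (update x i z') - partialDeriv f i x (z - z'))
          + (partialDeriv f i x - d i) (z - z') := by
      simp only [sub_apply, map_sub]; ring
    rw [e3]
    refine (abs_add_le _ _).trans (add_le_add (e1.trans ?_) (e2.trans ?_))
    · have := (h.c_pos i i).le
      gcongr
    · exact mul_le_mul_of_nonneg_left hzM (norm_nonneg _)
  have hfy : f y ≤ f p + ∑ i, b i * ‖y i - p i‖ := by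
    have := (_root_.abs_le.mp (abs_sub_le_sum_of_partialDeriv_le h.differentiable h.convex
      h.norm_partialDeriv_le hmem hpW)).2
    linarith
  have hterm : ∀ i, partialDeriv f i x (x i - y i)
      ≤ d i (x i - p i) + M * δ i + (b i + δ i) * ‖y i - p i‖ := fun i => by
    have e1 := (_root_.abs_le.mp ((partialDeriv f i x - d i).le_opNorm (x i - y i))).2
    have e2 : δ i * ‖x i - y i‖ ≤ M * δ i := by
      rw [mul_comm M]
      exact mul_le_mul_of_nonneg_left (h.norm_sub_le_of_mem i _ (hx i (mem_univ i)) _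
        (hmem i (mem_univ i))) (norm_nonneg _)
    have e3 : ‖d i‖ ≤ b i + δ i := by
      have e : d i = partialDeriv f i x - (partialDeriv f i x - d i) := by abel
      rw [e]
      exact (norm_sub_le _ _).trans (by gcongr; exact h.norm_partialDeriv_le x hx i)
    have e4 := (_root_.abs_le.mp ((d i).le_of_opNorm_le e3 (y i - p i))).1
    simp only [sub_apply, map_sub] at e1 e4 ⊢
    linarith
  have hsum := Finset.sum_le_sum fun i (_ : i ∈ Finset.univ) => hterm i
  have hB : ∑ i, (2 * b i + δ i) * ‖y i - p i‖
      ≤ ∑ i, (2 * b i + δ i) * (M ^ 3 * c i i + M ^ 2 * δ i) :=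
    Finset.sum_le_sum fun i _ => mul_le_mul_of_nonneg_left (hyp i)
      (by have := h.b_nonneg i; have := norm_nonneg (partialDeriv f i x - d i); positivity)
  have herr := sum_le_errorB₂ (b := b) (c := c) hM hε hd
  have hcomb : ∑ i, b i * ‖y i - p i‖ + ∑ i, (b i + δ i) * ‖y i - p i‖
      = ∑ i, (2 * b i + δ i) * ‖y i - p i‖ := by
    rw [← Finset.sum_add_distrib]
    exact Finset.sum_congr rfl fun i _ => by ring
  rw [Finset.sum_add_distrib, Finset.sum_add_distrib, ← Finset.mul_sum] at hsum
  have hlin : f x - linearizationError μ f x = f y + ∑ i, partialDeriv f i x (x i - y i) := by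
    rw [linearizationError]; ring
  rw [hlin]
  linarith

/-- The upper bound, for every upper bound `v` of the variational problem. -/
theorem log_integral_exp_le (h : BoundedSetting μ W f a b c M) {ε : ℝ} (hε : 0 ≤ ε)
    {D : Finset (∀ i, V i →L[ℝ] ℝ)}
    (hD : ∀ x ∈ univ.pi W, ∃ d ∈ D, ∑ i, ‖partialDeriv f i x - d i‖ ^ 2 ≤ ε ^ 2 * n)
    {v : ℝ} (hv : (v : EReal) ∈ upperBounds (meanFieldValues μ f)) :
    Real.log (∫ x, Real.exp (f x) ∂(Measure.pi μ))
      ≤ v + errorB₁ M a b c + errorB₂ M ε b c + Real.log (D.card : ℝ) := by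
  have hfc := h.differentiable.1.continuous
  set Z := ∫ x, Real.exp (f x) ∂(Measure.pi μ) with hZ
  have hZpos : 0 < Z := integral_exp_pos h.integrable_exp
  set S := ∑ i, M ^ 2 * c i i
  set K := errorB₁ M a b c + S with hK
  have hlc := h.continuousOn_linearizationError
  have hint1 : Integrable (fun x => Real.exp (f x - linearizationError μ f x)) (Measure.pi μ) :=
    integrable_pi_of_continuousOn μ h.isCompact h.ae_mem
      (Real.continuous_exp.comp_continuousOn (hfc.continuousOn.sub hlc))
  have hint2 : Integrable (fun x => linearizationError μ f x * Real.exp (f x)) (Measure.pi μ) :=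
    integrable_pi_of_continuousOn μ h.isCompact h.ae_mem
      (hlc.fun_mul (Real.continuous_exp.comp hfc).continuousOn)
  -- Jensen's inequality for the Gibbs measure, through the tangent line of the exponential
  have hjensen : Real.exp (-K) * Z
      ≤ ∫ x, Real.exp (f x - linearizationError μ f x) ∂(Measure.pi μ) := by
    have h1 := h.integral_linearizationError_mul_exp_le
    calc Real.exp (-K) * Z
        ≤ Real.exp (-K) * ((1 + K) * Z
            - ∫ x, linearizationError μ f x * Real.exp (f x) ∂(Measure.pi μ)) := by
          gcongr
          linarith
      _ = ∫ x, Real.exp (-K) * ((1 + K) * Real.exp (f x)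
            - linearizationError μ f x * Real.exp (f x)) ∂(Measure.pi μ) := by
          rw [integral_const_mul, integral_sub (h.integrable_exp.const_mul _) hint2,
            integral_const_mul]
      _ ≤ _ := by
          refine integral_mono (((h.integrable_exp.const_mul _).sub hint2).const_mul _) hint1
            fun x => ?_
          have h2 := Real.add_one_le_exp (K - linearizationError μ f x)
          calc Real.exp (-K) * ((1 + K) * Real.exp (f x)
                - linearizationError μ f x * Real.exp (f x))
              = Real.exp (-K) * Real.exp (f x) * (K - linearizationError μ f x + 1) := by ring
            _ ≤ Real.exp (-K) * Real.exp (f x) * Real.exp (K - linearizationError μ f x) := by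
                gcongr
            _ = _ := by rw [← Real.exp_add, ← Real.exp_add]; congr 1; ring
  let ζ : (∀ i, V i →L[ℝ] ℝ) → Fin n → ℝ := fun d i => ∫ z, Real.exp (d i z) ∂(μ i)
  have hdint : ∀ (d : ∀ i, V i →L[ℝ] ℝ) (i : Fin n),
      (∃ C : ℝ, ∀ᵐ z ∂(μ i), |d i z| ≤ C) := fun d i => by
    obtain ⟨C, hC⟩ := (h.isCompact i).exists_bound_of_continuousOn (d i).continuous.continuousOn
    exact ⟨C, (h.ae_mem i).mono hC⟩
  have hei : ∀ (d : ∀ i, V i →L[ℝ] ℝ) (i : Fin n),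
      Integrable (fun z => Real.exp (d i z)) (μ i) := fun d i => by
    obtain ⟨C, hC⟩ := hdint d i
    exact integrable_exp_of_ae_abs_le (d i).continuous.measurable.aemeasurable hC
  have hζ : ∀ d i, 0 < ζ d i := fun d i => integral_exp_pos (hei d i)
  -- the products of tilts are competitors in the variational problem
  have hcomp : ∀ d : ∀ i, V i →L[ℝ] ℝ, f (fun i => mean ((μ i).tilted (d i)))
      - ∑ i, d i (mean ((μ i).tilted (d i))) + ∑ i, Real.log (ζ d i) ≤ v := fun d => by
    have hprob : ∀ i, IsProbabilityMeasure ((μ i).tilted (d i)) := fun i =>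
      isProbabilityMeasure_tilted (hei d i)
    have hkl : ∀ i, klDiv ((μ i).tilted (d i)) (μ i) ≠ ⊤ ∧
        (klDiv ((μ i).tilted (d i)) (μ i)).toReal
          = d i (mean ((μ i).tilted (d i))) - Real.log (ζ d i) := fun i => by
      obtain ⟨C, hC⟩ := hdint d i
      obtain ⟨h1, h2⟩ := toReal_klDiv_tilted (d i).continuous.measurable.aemeasurable hC
      refine ⟨h1, h2.trans ?_⟩
      rw [(mean_spec (h.isCompact i) ?_ (d i)).2]
      rw [← mem_ae_iff_prob_eq_one (h.isCompact i).measurableSet]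
      exact (tilted_absolutelyContinuous (μ i) _).ae_le (h.ae_mem i)
    have h1 := hv (coe_mem_meanFieldValues (f := f) fun i => (hkl i).1)
    rw [EReal.coe_le_coe_iff, Finset.sum_congr rfl fun i _ => (hkl i).2,
      Finset.sum_sub_distrib] at h1
    linarith
  have hprodint : ∀ d : ∀ i, V i →L[ℝ] ℝ,
      Integrable (fun x : ∀ i, V i => ∏ i, Real.exp (d i (x i)) / ζ d i) (Measure.pi μ) :=
    fun d => Integrable.fintype_prod_dep fun i => (hei d i).div_const _
  have hprod : ∀ d : ∀ i, V i →L[ℝ] ℝ,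
      ∫ x, ∏ i, Real.exp (d i (x i)) / ζ d i ∂(Measure.pi μ) = 1 := fun d => by
    rw [integral_fintype_prod_eq_prod (fun i z => Real.exp (d i z) / ζ d i)]
    refine Finset.prod_eq_one fun i _ => ?_
    rw [integral_div]
    exact div_self (hζ d i).ne'
  set B := Real.exp (v + errorB₂ M ε b c - S) with hB
  have hupper : ∫ x, Real.exp (f x - linearizationError μ f x) ∂(Measure.pi μ)
      ≤ B * D.card := by
    calc ∫ x, Real.exp (f x - linearizationError μ f x) ∂(Measure.pi μ)
        ≤ ∫ x, B * ∑ d ∈ D, ∏ i, Real.exp (d i (x i)) / ζ d i ∂(Measure.pi μ) := by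
          refine integral_mono_ae hint1
            ((integrable_finsetSum _ fun d _ => hprodint d).const_mul _) ?_
          filter_upwards [ae_mem_univ_pi μ h.ae_mem] with x hx
          obtain ⟨d, hdD, hd⟩ := hD x hx
          have h1 := h.sub_linearizationError_le hε hx hd
          have h2 := hcomp d
          have hnn : ∀ d ∈ D, 0 ≤ ∏ i, Real.exp (d i (x i)) / ζ d i := fun d _ =>
            Finset.prod_nonneg fun i _ => div_nonneg (Real.exp_pos _).le (hζ d i).le
          have h3 : B * ∏ i, Real.exp (d i (x i)) / ζ d i
              = Real.exp (v + errorB₂ M ε b c - S + ∑ i, (d i (x i) - Real.log (ζ d i))) := by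
            rw [Real.exp_add, Real.exp_sum]
            congr 1
            refine Finset.prod_congr rfl fun i _ => ?_
            rw [Real.exp_sub, Real.exp_log (hζ d i)]
          calc Real.exp (f x - linearizationError μ f x)
              ≤ B * ∏ i, Real.exp (d i (x i)) / ζ d i := by
                rw [h3]
                refine Real.exp_le_exp.mpr ?_
                simp only [map_sub, Finset.sum_sub_distrib] at h1 ⊢
                linarith
            _ ≤ _ := by
                gcongr
                exact Finset.single_le_sum hnn hdD
      _ = B * D.card := by
          rw [integral_const_mul, integral_finsetSum _ fun d _ => hprodint d,
            Finset.sum_congr rfl fun d _ => hprod d]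
          simp
  have hDpos : (0 : ℝ) < D.card := by
    obtain ⟨x, hx⟩ := (ae_mem_univ_pi μ h.ae_mem).exists
    obtain ⟨d, hd, -⟩ := hD x hx
    exact_mod_cast Finset.card_pos.mpr ⟨d, hd⟩
  have hfinal : Real.log (Real.exp (-K) * Z) ≤ Real.log (B * D.card) :=
    Real.log_le_log (by positivity) (hjensen.trans hupper)
  rw [Real.log_mul (Real.exp_pos _).ne' hZpos.ne', Real.log_exp,
    Real.log_mul (Real.exp_pos _).ne' hDpos.ne', Real.log_exp] at hfinal
  linarith

end BoundedSetting
end MeanField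

end

theorem mainTheorem1 {n : ℕ} {V : Fin n → Type*}
    [∀ i, NormedAddCommGroup (V i)] [∀ i, NormedSpace ℝ (V i)] [∀ i, CompleteSpace (V i)]
    [∀ i, MeasurableSpace (V i)] [∀ i, BorelSpace (V i)]
    (μ : ∀ i, Measure (V i)) [∀ i, IsProbabilityMeasure (μ i)]
    (W : ∀ i, Set (V i)) (hWcompact : ∀ i, IsCompact (W i)) (hWconvex : ∀ i, Convex ℝ (W i))
    (hμW : ∀ i, μ i (W i) = 1)
    (f : (∀ i, V i) → ℝ) (hf : MeanField.TwiceFrechetDifferentiable f)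
    (a : ℝ) (b : Fin n → ℝ) (c : Fin n → Fin n → ℝ)
    (ha : 0 < a) (hb : ∀ i, 0 < b i) (hc : ∀ i j, 0 < c i j)
    (hfa : ∀ x ∈ Set.univ.pi W, |f x| ≤ a)
    (hfb : ∀ x ∈ Set.univ.pi W, ∀ i, ‖MeanField.partialDeriv f i x‖ ≤ b i)
    (hfc : ∀ x ∈ Set.univ.pi W, ∀ i j, ∀ (z : V i) (r : V j), max ‖r‖ ‖z‖ ≤ 1 →
      |MeanField.partialDeriv₂ f i j x z r| ≤ c i j)
    (M : ℝ) (hM : 0 < M) (hWM : ∀ i, ∀ z₁ ∈ W i, ∀ z₂ ∈ W i, ‖z₁ - z₂‖ ≤ M)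
    (ε : ℝ) (hε : 0 < ε) (D : Finset (∀ i, V i →L[ℝ] ℝ))
    (hD : ∀ x ∈ Set.univ.pi W, ∃ d ∈ D,
      ∑ i, ‖MeanField.partialDeriv f i x - d i‖ ^ 2 ≤ ε ^ 2 * n) :
    IntegrableOn (fun x => Real.exp (f x)) (Set.univ.pi W) (Measure.pi μ) ∧
    ∃ v : ℝ, IsGreatest (MeanField.meanFieldValues μ f) (v : EReal) ∧
      Real.log (∫ x in Set.univ.pi W, Real.exp (f x) ∂(Measure.pi μ)) ≤
        v + MeanField.errorB₁ M a b c + MeanField.errorB₂ M ε b c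
          + Real.log 2 + Real.log (D.card : ℝ) ∧
      v - M ^ 2 / 2 * ∑ i, c i i ≤
        Real.log (∫ x in Set.univ.pi W, Real.exp (f x) ∂(Measure.pi μ)) := by
  have hae : ∀ i, ∀ᵐ z ∂(μ i), z ∈ W i := fun i =>
    (mem_ae_iff_prob_eq_one (hWcompact i).measurableSet).mpr (hμW i)
  have h : MeanField.BoundedSetting μ W f a b c M :=
    ⟨hWcompact, hWconvex, hae, hf, fun i => (hb i).le, hc, hfa, hfb, hfc, hM.le, hWM⟩
  obtain ⟨v, hv⟩ := MeanField.exists_isGreatest_meanFieldValues hWcompact hWconvex hae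
    hf.1.continuous
  refine ⟨h.integrable_exp.integrableOn, v, hv, ?_, ?_⟩ <;>
    rw [Measure.restrict_eq_self_of_ae_mem (MeanField.ae_mem_univ_pi μ hae)]
  · have h1 := h.log_integral_exp_le hε.le hD hv.2
    have h2 := Real.log_nonneg one_le_two
    linarith
  · rcases MeanField.exists_of_mem_meanFieldValues hv.1 with h0 | ⟨ν, hν, hk, hvν⟩
    · exact absurd h0 (EReal.coe_ne_bot v)
    · rw [EReal.coe_eq_coe_iff.mp hvν]
      exact h.sub_sum_klDiv_le_log_integral_exp hk
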